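/- Let $\alpha,\beta>-1$, $w_{\alpha,\beta}(t)=(1-t)^\alpha(1+t)^\beta$ on $[-1,1]$, and let $L_p(w_{\alpha,\beta})$ be the space of complex-valued Lebesgue measurable functions $f$ on $[-1,1]$ with finite norm $\|f\|_{L_p(w_{\alpha,\beta})}=\bigl(\int_{-1}^1|f(t)|^p\,w_{\alpha,\beta}(t)\,dt\bigr)^{1/p}$. Let $P_n^{(\alpha,\beta)}$, $n\in\mathbb{N}_0=\{0,1,2,\dots\}$, be the Jacobi polynomials, let $$\widetilde P_n^{(\alpha,\beta)}=\Bigl(\int_{-1}^1\bigl(P_n^{(\alpha,\beta)}(t)\bigr)^2\,w_{\alpha,\beta}(t)\,dt\Bigr)^{-1/2}P_n^{(\alpha,\beta)}$$ be the orthonormal ones, and put $\hat f_n=\int_{-1}^1 f(t)\,\widetilde P_n^{(\alpha,\beta)}(t)\,w_{\alpha,\beta}(t)\,dt$ and $\sigma=\max\bigl(0,\tfrac12+\max(\alpha,\beta)\bigr)$. A prime denotes the conjugate exponent, $\frac1p+\frac1{p'}=1$. For a function $\omega:\mathbb{N}_0\to(0,\infty)$ put $$M_\omega=\sup_{t>0}\Bigl\{t\sum_{\omega(n)\ge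 t}(n+1)^{2\sigma}\Bigr\}\in(0,\infty].$$ There are finite constants $C_p(s)$ ($1<p\le2$, $p\le s\le p'$), which depend only on $p$, $s$, $\alpha$ and $\beta$, such that the following holds. (a) If $1<p\le 2$, $p\le s\le p'$, $f\in L_p(w_{\alpha,\beta})$, and $\omega:\mathbb{N}_0\to(0,\infty)$ satisfies $M_\omega<\infty$, then $$\Bigl\{\sum_{n=0}^\infty\Bigl((n+1)^{(\frac2s-1)\sigma}\,\omega(n)^{\frac1s-\frac1{p'}}\,|\hat f_n|\Bigr)^s\Bigr\}^{1/s}\le C_p(s)\,M_\omega^{\frac1s-\frac1{p'}}\,\|f\|_{L_p(w_{\alpha,\beta})}.$$ (b) If $2\le q<\infty$, $q'\le r\le q$, $\omega:\mathbb{N}_0\to(0,\infty)$ satisfies $M_\omega<\infty$, and $\phi:\mathbb{N}_0\to[0,\infty)$ satisfies $$\sum_{n=0}^\infty\Bigl((n+1)^{(1-\frac2r)\sigma}\,\omega(n)^{\frac1q-\frac1r}\,|\phi(n)|\Bigr)^{r'}<\infty,$$ then the polynomials $\Phi_N=\sum_{n=0}^N\phi(n)\,\widetilde P_n^{(\alpha,\beta)}$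 converge in $L_q(w_{\alpha,\beta})$, as $N\to\infty$, to a function $f$ satisfying $\hat f_n=\phi(n)$ for all $n\in\mathbb{N}_0$, and $$\|f\|_{L_q(w_{\alpha,\beta})}\le C_{q'}(r)\,M_\omega^{\frac1r-\frac1q}\,\Bigl\{\sum_{n=0}^\infty\Bigl((n+1)^{(1-\frac2r)\sigma}\,\omega(n)^{\frac1q-\frac1r}\,|\phi(n)|\Bigr)^{r'}\Bigr\}^{1/r'}.$$ -/

import Mathlib

open MeasureTheory Filter Topology
open scoped NNReal ENNReal

noncomputable section

/-- The Jacobi weight `(1 - t)^α (1 + t)^β`. -/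
def jacobiWeight (α β t : ℝ) : ℝ := (1 - t) ^ α * (1 + t) ^ β

/-- The measure `(1 - t)^α (1 + t)^β dt` on `[-1, 1]`, as a measure on `ℝ`;
the space `L_p` with the Jacobi weight is the `L_p` space of this measure. -/
def jacobiMeasure (α β : ℝ) : Measure ℝ :=
  (volume.restrict (Set.Icc (-1) 1)).withDensity fun t => ENNReal.ofReal (jacobiWeight α β t)

/-- The classical Jacobi polynomial of degree `n`, in the standard normalization:
`(1 / n!) ∑ k ≤ n, (n choose k) (n + α + β + 1)_k (α + k + 1)_{n - k} ((x - 1) / 2)^k`,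
where `(a)_k = a (a + 1) ⋯ (a + k - 1)`. -/
def jacobiP (α β : ℝ) (n : ℕ) : Polynomial ℝ :=
  ∑ k ∈ Finset.range (n + 1),
    Polynomial.C ((n.choose k : ℝ) / (n.factorial : ℝ)
        * (ascPochhammer ℝ k).eval ((n : ℝ) + α + β + 1)
        * (ascPochhammer ℝ (n - k)).eval (α + (k : ℝ) + 1))
      * (Polynomial.C (1 / 2 : ℝ) * (Polynomial.X - 1)) ^ k

/-- The norm of the `n`-th Jacobi polynomial in the weighted `L_2` space. -/
def jacobiH (α β : ℝ) (n : ℕ) : ℝ :=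
  (∫ t, (jacobiP α β n).eval t ^ 2 ∂jacobiMeasure α β) ^ (1 / 2 : ℝ)

/-- The orthonormal Jacobi polynomial, as a function. -/
def jacobiON (α β : ℝ) (n : ℕ) (t : ℝ) : ℝ := (jacobiH α β n)⁻¹ * (jacobiP α β n).eval t

/-- The `n`-th Fourier–Jacobi coefficient of `f`. -/
def jacobiCoeff (α β : ℝ) (f : ℝ → ℂ) (n : ℕ) : ℂ :=
  ∫ t, f t * (jacobiON α β n t : ℂ) ∂jacobiMeasure α β

/-- The exponent `σ(α, β) = max (0, 1/2 + max (α, β))`. -/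
def jacobiSigma (α β : ℝ) : ℝ := max 0 (1 / 2 + max α β)

/-- `M_ω = sup_{t > 0} t ∑_{ω(n) ≥ t} (n + 1)^{2 σ(α, β)}`, a value in `[0, ∞]`. -/
def paleyM (α β : ℝ) (ω : ℕ → ℝ) : ℝ≥0∞ :=
  ⨆ (t : ℝ) (_ : 0 < t), ENNReal.ofReal t *
    ∑' n : {n : ℕ // t ≤ ω n}, ENNReal.ofReal (((n : ℕ) + 1 : ℝ) ^ (2 * jacobiSigma α β))

end

/-!
The Hausdorff–Young–Paley inequality for Jacobi expansions is real interpolation between two facts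
about the orthonormal Jacobi polynomials `e n`: Bessel's inequality, and the uniform bound
`|e n| ≤ K (n + 1) ^ σ` on `[-1, 1]` (`exists_abs_jacobiON_le`).

*The uniform bound.* All integrals that are needed come from the Pearson equation of the weight
(`integral_pearson`): the Sturm–Liouville form, hence orthogonality, and, since the derivative of a
Jacobi polynomial is a Jacobi polynomial with both parameters raised by one, the ratio of
consecutive squared norms (`jacobiNormSq_ratio`). Pointwise control comes from Sonin's function
`λ y² + (1 - t²) y'²`, whose derivative is `y'²` times a linear function of `t`. If
`max α β ≥ -1/2`, the extremes lie at the endpoints, where the values are explicit and are compared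
with the norms by Euler's limit formula for `Γ` (`exists_eval_one_sq_le`). If both parameters are
below `-1/2`, the maximum of Sonin's function is at a fixed interior point and persists on a
neighbourhood independent of `n`; since the integral of Sonin's function is `2 λ ‖y‖²`, the maximum
of `y²` is `O(‖y‖²)` (`exists_jacobiP_sq_le_of_lt`).

*Interpolation.* For a system with these two properties (`IsBesselSystem`), with bounds `K d n`, the
map `f ↦ |f̂ n| / (ω n d n)` is of strong type `(2, 2)` and, by the hypothesis on `ω`, of weak type
`(1, 1)` for the weights `(ω n d n) ^ 2`. Marcinkiewicz' truncation argument gives Paley's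
inequality, the case `s = p` (`IsBesselSystem.paley`). The case `s = p'` follows from it by choosing
`ω` in terms of the distribution of the coefficients themselves
(`IsBesselSystem.hausdorff_young`), and Hölder's inequality fills in the exponents between.

*Synthesis.* Testing a finite sum `Φ` against `|Φ| ^ (q - 2) Φ` turns the coefficient estimate on
`L^{q'}` into a bound for `‖Φ‖_q` (`IsBesselSystem.integral_sum_rpow_le`). Applied to the blocks of
the series, it gives summability in the complete space `L^q`, and the bound passes to the sum.
-/

/-! ### Jacobi polynomials: special values and the differential equation -/

open Polynomial in
theorem eval_one_jacobiP (α β : ℝ) (n : ℕ) :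
    (jacobiP α β n).eval 1 = (ascPochhammer ℝ n).eval (α + 1) / n.factorial := by
  rw [jacobiP, Finset.sum_range_succ', eval_add, eval_finsetSum, Finset.sum_eq_zero]
  · simp [div_eq_inv_mul]
  · intro k _
    simp

open Polynomial in
/-- The derivative is a Jacobi polynomial with both parameters raised by one. This drives the
inductions on the degree below. -/
theorem derivative_jacobiP_succ (α β : ℝ) (n : ℕ) :
    derivative (jacobiP α β (n + 1))
      = C (((n : ℝ) + α + β + 2) / 2) * jacobiP (α + 1) (β + 1) n := by
  rw [jacobiP, Finset.sum_range_succ', derivative_add, derivative_sum, jacobiP, Finset.mul_sum]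
  simp only [pow_zero, mul_one, derivative_C, add_zero]
  refine Finset.sum_congr rfl fun k _ => ?_
  have hd : derivative ((C (1 / 2 : ℝ) * (X - 1)) ^ (k + 1))
      = C (((k : ℝ) + 1) / 2) * (C (1 / 2 : ℝ) * (X - 1)) ^ k := by
    rw [derivative_pow_succ]
    simp only [derivative_C_mul, derivative_sub, derivative_X, derivative_one, sub_zero, mul_one]
    rw [div_eq_mul_one_div ((k : ℝ) + 1) 2, C_mul]
    simp only [map_add, map_natCast, map_one]
    ring
  rw [derivative_C_mul, hd, ← mul_assoc, ← mul_assoc, ← C_mul, ← C_mul]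
  congr 2
  have hc : ((n + 1).choose (k + 1) : ℝ) * ((k : ℝ) + 1) = ((n : ℝ) + 1) * (n.choose k : ℝ) := by
    exact_mod_cast (Nat.add_one_mul_choose_eq n k).symm
  have hf : ((n + 1).factorial : ℝ) = ((n : ℝ) + 1) * n.factorial := by
    rw [Nat.factorial_succ]; push_cast; ring
  have hn : ((n : ℝ) + 1) ≠ 0 := by positivity
  have hn' : (n.factorial : ℝ) ≠ 0 := by positivity
  have hp : (ascPochhammer ℝ (k + 1)).eval (((n + 1 : ℕ) : ℝ) + α + β + 1)
      = ((n : ℝ) + α + β + 2) * (ascPochhammer ℝ k).eval ((n : ℝ) + (α + 1) + (β + 1) + 1) := by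
    rw [ascPochhammer_succ_left, eval_mul, eval_X, eval_comp, eval_add, eval_X, eval_one]
    have h1 : ((n + 1 : ℕ) : ℝ) + α + β + 1 = n + α + β + 2 := by push_cast; ring
    have h2 : (n : ℝ) + α + β + 2 + 1 = n + (α + 1) + (β + 1) + 1 := by ring
    rw [h1, h2]
  have hs : n + 1 - (k + 1) = n - k := by omega
  have he : α + ((k + 1 : ℕ) : ℝ) + 1 = α + 1 + (k : ℝ) + 1 := by push_cast; ring
  rw [hp, hs, he, hf]
  have key : ((n + 1).choose (k + 1) : ℝ) / (((n : ℝ) + 1) * n.factorial) * (((k : ℝ) + 1) / 2)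
      = (n.choose k : ℝ) / n.factorial / 2 := by
    field_simp
    linear_combination hc
  linear_combination (((n : ℝ) + α + β + 2) *
    (ascPochhammer ℝ k).eval ((n : ℝ) + (α + 1) + (β + 1) + 1) *
      (ascPochhammer ℝ (n - k)).eval (α + 1 + (k : ℝ) + 1)) * key

theorem eval_one_jacobiP_succ (α β : ℝ) (n : ℕ) :
    ((n : ℝ) + 1) * (jacobiP α β (n + 1)).eval 1 = ((n : ℝ) + α + 1) * (jacobiP α β n).eval 1 := by
  rw [eval_one_jacobiP, eval_one_jacobiP, ascPochhammer_succ_eval, Nat.factorial_succ]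
  have hn : ((n : ℝ) + 1) ≠ 0 := by positivity
  have hn' : (n.factorial : ℝ) ≠ 0 := by positivity
  push_cast
  field_simp
  ring

theorem eval_one_jacobiP_shift (α β : ℝ) (n : ℕ) :
    ((n : ℝ) + 1) * (jacobiP α β (n + 1)).eval 1
      = (α + 1) * (jacobiP (α + 1) (β + 1) n).eval 1 := by
  rw [eval_one_jacobiP, eval_one_jacobiP, ascPochhammer_succ_left, Nat.factorial_succ]
  have hn : ((n : ℝ) + 1) ≠ 0 := by positivity
  have hn' : (n.factorial : ℝ) ≠ 0 := by positivity
  simp only [Polynomial.eval_mul, Polynomial.eval_comp, Polynomial.eval_X, Polynomial.eval_add,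
    Polynomial.eval_one]
  push_cast
  field_simp

open Polynomial in
/-- The Jacobi differential equation. -/
theorem jacobiP_ode (n : ℕ) : ∀ α β : ℝ,
    (1 - X ^ 2) * derivative (derivative (jacobiP α β n))
      + (C (β - α) - C (α + β + 2) * X) * derivative (jacobiP α β n)
      + C ((n : ℝ) * (n + α + β + 1)) * jacobiP α β n = 0 := by
  induction n with
  | zero => intro α β; simp [jacobiP]
  | succ n ih =>
    intro α β
    set E := (1 - X ^ 2) * derivative (derivative (jacobiP α β (n + 1)))
      + (C (β - α) - C (α + β + 2) * X) * derivative (jacobiP α β (n + 1))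
      + C (((n + 1 : ℕ) : ℝ) * ((n + 1 : ℕ) + α + β + 1)) * jacobiP α β (n + 1) with hE
    -- Differentiating the equation gives the equation for the shifted parameters.
    have hD : derivative E = 0 := by
      have hD' : derivative E = C (((n : ℝ) + α + β + 2) / 2) * 0 := by
        rw [← ih (α + 1) (β + 1)]
        simp only [hE, derivative_add, derivative_mul, derivative_jacobiP_succ, derivative_C,
          derivative_sub, derivative_X_pow, derivative_one, derivative_X, derivative_zero]
        push_cast
        simp only [map_add, map_sub, map_mul, map_natCast, map_one, map_ofNat]
        ring
      rw [hD', mul_zero]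
    obtain ⟨c, hc⟩ : ∃ c, E = C c :=
      ⟨_, eq_C_of_natDegree_eq_zero (derivative_eq_zero.1 hD)⟩
    have h1 : E.eval 1 = 0 := by
      simp only [hE, derivative_jacobiP_succ, eval_add, eval_mul, eval_sub, eval_pow, eval_X,
        eval_one, eval_C]
      push_cast
      linear_combination ((n : ℝ) + α + β + 2) * eval_one_jacobiP_shift α β n
    rw [hc] at h1 ⊢
    simpa using h1

theorem eval_neg_one_jacobiP_shift (α β : ℝ) (hα : -1 < α) (hβ : -1 < β) (n : ℕ) :
    ((n : ℝ) + 1) * (jacobiP α β (n + 1)).eval (-1)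
      = -(β + 1) * (jacobiP (α + 1) (β + 1) n).eval (-1) := by
  have h := congrArg (Polynomial.eval (-1)) (jacobiP_ode (n + 1) α β)
  simp only [derivative_jacobiP_succ, Polynomial.eval_add, Polynomial.eval_mul, Polynomial.eval_sub,
    Polynomial.eval_pow, Polynomial.eval_X, Polynomial.eval_one, Polynomial.eval_C,
    Polynomial.eval_zero] at h
  have hp : (n : ℝ) + α + β + 2 ≠ 0 := by
    have : (0 : ℝ) ≤ n := n.cast_nonneg
    linarith
  refine mul_left_cancel₀ hp ?_
  push_cast at h
  linear_combination h

/-- Up to sign, the value at `-1` is the value at `1` with the parameters exchanged. -/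
theorem eval_neg_one_jacobiP_sq (n : ℕ) : ∀ α β : ℝ, -1 < α → -1 < β →
    (jacobiP α β n).eval (-1) ^ 2 = (jacobiP β α n).eval 1 ^ 2 := by
  induction n with
  | zero => intro α β _ _; simp [jacobiP]
  | succ n ih =>
    intro α β hα hβ
    have hn : ((n : ℝ) + 1) ^ 2 ≠ 0 := by positivity
    refine mul_left_cancel₀ hn ?_
    rw [← mul_pow, ← mul_pow, eval_neg_one_jacobiP_shift α β hα hβ, eval_one_jacobiP_shift,
      mul_pow, mul_pow, neg_sq, ih (α + 1) (β + 1) (by linarith) (by linarith)]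

/-! ### The Jacobi measure, orthogonality and norms -/

theorem jacobiWeight_pos (α β : ℝ) {t : ℝ} (ht : t ∈ Set.Ioo (-1 : ℝ) 1) :
    0 < jacobiWeight α β t :=
  mul_pos (Real.rpow_pos_of_pos (by linarith [ht.2]) _) (Real.rpow_pos_of_pos (by linarith [ht.1]) _)

theorem measurable_jacobiWeight (α β : ℝ) : Measurable (jacobiWeight α β) := by
  unfold jacobiWeight
  fun_prop

theorem intervalIntegrable_jacobiWeight {α β : ℝ} (hα : -1 < α) (hβ : -1 < β) :
    IntervalIntegrable (jacobiWeight α β) volume (-1) 1 := by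
  have h1 : IntervalIntegrable (fun t : ℝ => (1 - t) ^ α) volume 0 1 := by
    have := (intervalIntegral.intervalIntegrable_rpow' (a := 1) (b := 0) hα).comp_sub_left 1
    simpa using this
  have h2 : IntervalIntegrable (fun t : ℝ => (1 + t) ^ β) volume (-1) 0 := by
    have := (intervalIntegral.intervalIntegrable_rpow' (a := 0) (b := 1) hβ).comp_add_left 1
    simpa using this
  refine IntervalIntegrable.trans (b := 0) ?_ ?_
  · refine h2.continuousOn_mul (f := fun t : ℝ => (1 + t) ^ β) (g := fun t => (1 - t) ^ α) ?_
    rw [Set.uIcc_of_le (by norm_num)]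
    refine ContinuousOn.rpow_const (by fun_prop) fun t ht => Or.inl ?_
    linarith [ht.2]
  · refine h1.mul_continuousOn (f := fun t : ℝ => (1 - t) ^ α) (g := fun t => (1 + t) ^ β) ?_
    rw [Set.uIcc_of_le (by norm_num)]
    refine ContinuousOn.rpow_const (by fun_prop) fun t ht => Or.inl ?_
    linarith [ht.1]

theorem integrableOn_jacobiWeight {α β : ℝ} (hα : -1 < α) (hβ : -1 < β) :
    IntegrableOn (jacobiWeight α β) (Set.Icc (-1) 1) :=
  (intervalIntegrable_iff_integrableOn_Icc_of_le (by norm_num)).1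
    (intervalIntegrable_jacobiWeight hα hβ)

theorem isFiniteMeasure_jacobiMeasure {α β : ℝ} (hα : -1 < α) (hβ : -1 < β) :
    IsFiniteMeasure (jacobiMeasure α β) :=
  isFiniteMeasure_withDensity_ofReal (integrableOn_jacobiWeight hα hβ).2

theorem jacobiMeasure_eq_Ioo (α β : ℝ) : jacobiMeasure α β =
    (volume.restrict (Set.Ioo (-1) 1)).withDensity
      fun t => ENNReal.ofReal (jacobiWeight α β t) := by
  rw [jacobiMeasure, Measure.restrict_congr_set Ioo_ae_eq_Icc]

theorem ae_mem_Ioo_jacobiMeasure (α β : ℝ) : ∀ᵐ t ∂jacobiMeasure α β, t ∈ Set.Ioo (-1 : ℝ) 1 := by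
  rw [jacobiMeasure_eq_Ioo]
  exact (withDensity_absolutelyContinuous _ _).ae_le (ae_restrict_mem measurableSet_Ioo)

theorem integral_jacobiMeasure (α β : ℝ) (g : ℝ → ℝ) :
    ∫ t, g t ∂jacobiMeasure α β = ∫ t in Set.Ioo (-1 : ℝ) 1, jacobiWeight α β t * g t := by
  rw [jacobiMeasure_eq_Ioo, integral_withDensity_eq_integral_toReal_smul
    (measurable_jacobiWeight α β).ennreal_ofReal (by simp)]
  refine setIntegral_congr_fun measurableSet_Ioo fun t ht => ?_
  simp only [smul_eq_mul]
  rw [ENNReal.toReal_ofReal (jacobiWeight_pos α β ht).le]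

theorem integral_jacobiMeasure_add_one (α β : ℝ) (g : ℝ → ℝ) :
    ∫ t, g t ∂jacobiMeasure (α + 1) (β + 1) = ∫ t, (1 - t ^ 2) * g t ∂jacobiMeasure α β := by
  rw [integral_jacobiMeasure, integral_jacobiMeasure]
  refine setIntegral_congr_fun measurableSet_Ioo fun t ht => ?_
  simp only [jacobiWeight]
  rw [Real.rpow_add_one (by linarith [ht.2]), Real.rpow_add_one (by linarith [ht.1])]
  ring

theorem integrable_jacobiMeasure {α β : ℝ} (hα : -1 < α) (hβ : -1 < β) {g : ℝ → ℝ}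
    (hg : Continuous g) : Integrable g (jacobiMeasure α β) := by
  have := isFiniteMeasure_jacobiMeasure hα hβ
  obtain ⟨B, hB⟩ := isCompact_Icc.exists_bound_of_continuousOn (s := Set.Icc (-1 : ℝ) 1)
    hg.continuousOn
  refine Integrable.of_bound hg.aestronglyMeasurable B ?_
  filter_upwards [ae_mem_Ioo_jacobiMeasure α β] with t ht
  exact hB t (Set.Ioo_subset_Icc_self ht)

open Polynomial in
/-- Integration of the derivative of `(1 - t²) w(t) R(t)`, which vanishes at both endpoints:
the Pearson equation of the Jacobi weight in integrated form. -/
theorem integral_pearson {α β : ℝ} (hα : -1 < α) (hβ : -1 < β) (R : ℝ[X]) :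
    ∫ t, ((1 - t ^ 2) * (derivative R).eval t + (β - α - (α + β + 2) * t) * R.eval t)
      ∂jacobiMeasure α β = 0 := by
  rw [integral_jacobiMeasure, ← integral_Ioc_eq_integral_Ioo,
    ← intervalIntegral.integral_of_le (by norm_num)]
  have hc : ContinuousOn (fun t : ℝ => (1 - t) ^ (α + 1) * (1 + t) ^ (β + 1) * R.eval t)
      (Set.Icc (-1) 1) := by
    refine ContinuousOn.mul (ContinuousOn.mul ?_ ?_) R.continuous.continuousOn
    · exact ContinuousOn.rpow_const (by fun_prop) fun t _ => Or.inr (by linarith)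
    · exact ContinuousOn.rpow_const (by fun_prop) fun t _ => Or.inr (by linarith)
  rw [intervalIntegral.integral_eq_sub_of_hasDerivAt_of_le (by norm_num) hc]
  · have hα' : α + 1 ≠ 0 := by linarith
    have hβ' : β + 1 ≠ 0 := by linarith
    simp [Real.zero_rpow hα', Real.zero_rpow hβ']
  · intro t ht
    have h1 : (1 - t) ≠ 0 := by linarith [ht.2]
    have h2 : (1 + t) ≠ 0 := by linarith [ht.1]
    have d1 := ((hasDerivAt_id t).const_sub 1).rpow_const (p := α + 1) (Or.inl h1)
    have d2 := ((hasDerivAt_id t).const_add 1).rpow_const (p := β + 1) (Or.inl h2)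
    refine ((d1.mul d2).mul (R.hasDerivAt t)).congr_deriv ?_
    simp only [id, jacobiWeight, add_sub_cancel_right, Pi.mul_apply]
    rw [Real.rpow_add_one h1, Real.rpow_add_one h2]
    ring
  · exact (intervalIntegrable_jacobiWeight hα hβ).mul_continuousOn (by fun_prop)

open Polynomial in
/-- The weak form of the differential equation. -/
theorem integral_jacobiP_sturm_liouville {α β : ℝ} (hα : -1 < α) (hβ : -1 < β) (n : ℕ) (Q : ℝ[X]) :
    ∫ t, (1 - t ^ 2) * ((derivative (jacobiP α β n)).eval t * (derivative Q).eval t)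
        ∂jacobiMeasure α β
      = (n : ℝ) * (n + α + β + 1) * ∫ t, (jacobiP α β n).eval t * Q.eval t ∂jacobiMeasure α β := by
  have h := integral_pearson hα hβ (derivative (jacobiP α β n) * Q)
  rw [← integral_const_mul, ← sub_eq_zero, ← integral_sub, ← h]
  · refine integral_congr_ae (Eventually.of_forall fun t => ?_)
    have ho := congrArg (Polynomial.eval t) (jacobiP_ode n α β)
    simp only [eval_add, eval_mul, eval_sub, eval_pow, eval_X, eval_one, eval_C, eval_zero] at ho
    simp only [derivative_mul, eval_add, eval_mul]
    linear_combination (-Q.eval t) * ho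
  · exact integrable_jacobiMeasure hα hβ (by fun_prop)
  · exact integrable_jacobiMeasure hα hβ (by fun_prop)

theorem integral_jacobiP_mul_jacobiP {α β : ℝ} (hα : -1 < α) (hβ : -1 < β) {m n : ℕ} (hmn : m ≠ n) :
    ∫ t, (jacobiP α β m).eval t * (jacobiP α β n).eval t ∂jacobiMeasure α β = 0 := by
  have h1 := integral_jacobiP_sturm_liouville hα hβ m (jacobiP α β n)
  have h2 := integral_jacobiP_sturm_liouville hα hβ n (jacobiP α β m)
  simp only [mul_comm ((jacobiP α β n).eval _), mul_comm ((jacobiP α β n).derivative.eval _)] at h2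
  rw [h1] at h2
  have h3 : ((m : ℝ) - n) * (m + n + α + β + 1) ≠ 0 := by
    refine mul_ne_zero (sub_ne_zero.2 (by exact_mod_cast hmn)) ?_
    have : (1 : ℝ) ≤ m + n := by exact_mod_cast (by omega : 1 ≤ m + n)
    linarith
  refine (mul_eq_zero.1 ?_).resolve_left h3
  linear_combination h2

/-- The squared norm of the classical Jacobi polynomial in the weighted `L²` space. -/
noncomputable def jacobiNormSq (α β : ℝ) (n : ℕ) : ℝ :=
  ∫ t, (jacobiP α β n).eval t ^ 2 ∂jacobiMeasure α β

theorem integral_one_sub_sq_mul_derivative_sq {α β : ℝ} (hα : -1 < α) (hβ : -1 < β) (n : ℕ) :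
    ∫ t, (1 - t ^ 2) * ((jacobiP α β n).derivative.eval t) ^ 2 ∂jacobiMeasure α β
      = (n : ℝ) * (n + α + β + 1) * jacobiNormSq α β n := by
  simpa only [← pow_two, jacobiNormSq] using
    integral_jacobiP_sturm_liouville hα hβ n (jacobiP α β n)

theorem jacobiNormSq_succ {α β : ℝ} (hα : -1 < α) (hβ : -1 < β) (n : ℕ) :
    4 * ((n : ℝ) + 1) * jacobiNormSq α β (n + 1)
      = (n + α + β + 2) * jacobiNormSq (α + 1) (β + 1) n := by
  have h := integral_one_sub_sq_mul_derivative_sq hα hβ (n + 1)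
  simp only [derivative_jacobiP_succ, Polynomial.eval_mul, Polynomial.eval_C, mul_pow,
    mul_left_comm (1 - _ ^ 2) ((((n : ℝ) + α + β + 2) / 2) ^ 2)] at h
  rw [integral_const_mul, ← integral_jacobiMeasure_add_one] at h
  have hp : (n : ℝ) + α + β + 2 ≠ 0 := by
    have : (0 : ℝ) ≤ n := n.cast_nonneg
    linarith
  refine mul_left_cancel₀ hp ?_
  change _ * jacobiNormSq (α + 1) (β + 1) n = _ at h
  push_cast at h
  linear_combination (-4) * h

open Polynomial in
/-- The Pearson equation for the polynomials `1` and `X` determines the first two moments of the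
Jacobi measure relative to its mass. -/
theorem jacobiNormSq_zero_add_one {α β : ℝ} (hα : -1 < α) (hβ : -1 < β) :
    (α + β + 2) * (α + β + 3) * jacobiNormSq (α + 1) (β + 1) 0
      = 4 * (α + 1) * (β + 1) * jacobiNormSq α β 0 := by
  have h0 : ∀ a b t : ℝ, (jacobiP a b 0).eval t ^ 2 = 1 := by intro a b t; simp [jacobiP]
  simp only [jacobiNormSq, h0]
  rw [integral_jacobiMeasure_add_one]
  have hi : ∀ g : ℝ → ℝ, Continuous g → Integrable g (jacobiMeasure α β) :=
    fun g hg => integrable_jacobiMeasure hα hβ hg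
  have h1 := integral_pearson hα hβ 1
  have h2 := integral_pearson hα hβ X
  simp only [derivative_one, eval_zero, eval_one, mul_zero, zero_add, mul_one, derivative_X,
    eval_X] at h1 h2
  have h3 : ∫ t, (α + β + 2) * (1 - t ^ 2 + (β - α - (α + β + 2) * t) * t)
      + (β - α) * (β - α - (α + β + 2) * t) ∂jacobiMeasure α β = 0 := by
    rw [integral_add (hi _ (by fun_prop)) (hi _ (by fun_prop)), integral_const_mul,
      integral_const_mul, h1, h2]
    simp
  rw [← integral_const_mul, ← integral_const_mul, ← sub_eq_zero,
    ← integral_sub (hi _ (by fun_prop)) (hi _ (by fun_prop)), ← h3]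
  refine integral_congr_ae (Eventually.of_forall fun t => ?_)
  simp only
  ring

theorem jacobiNormSq_zero_pos {α β : ℝ} (hα : -1 < α) (hβ : -1 < β) : 0 < jacobiNormSq α β 0 := by
  have h0 : ∀ t : ℝ, (jacobiP α β 0).eval t ^ 2 = 1 := by intro t; simp [jacobiP]
  simp only [jacobiNormSq, h0]
  rw [integral_jacobiMeasure, ← integral_Ioc_eq_integral_Ioo,
    ← intervalIntegral.integral_of_le (by norm_num)]
  refine intervalIntegral.intervalIntegral_pos_of_pos_on ?_ ?_ (by norm_num)
  · simpa using intervalIntegrable_jacobiWeight hα hβ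
  · intro t ht
    simpa using jacobiWeight_pos α β ht

theorem jacobiNormSq_pos (n : ℕ) : ∀ {α β : ℝ}, -1 < α → -1 < β → 0 < jacobiNormSq α β n := by
  induction n with
  | zero => exact jacobiNormSq_zero_pos
  | succ n ih =>
    intro α β hα hβ
    have hn : (0 : ℝ) ≤ n := n.cast_nonneg
    have h := jacobiNormSq_succ hα hβ n
    have h1 := ih (α := α + 1) (β := β + 1) (by linarith) (by linarith)
    have h2 : 0 < ((n : ℝ) + α + β + 2) * jacobiNormSq (α + 1) (β + 1) n :=
      mul_pos (by linarith) h1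
    rw [← h] at h2
    exact pos_of_mul_pos_right h2 (by positivity)

/-- The ratio of consecutive squared norms of classical Jacobi polynomials, from degree `1` on: in
the ratio of the degrees `1` and `0` the formula has the factor `α + β + 1`, which may vanish. -/
theorem jacobiNormSq_ratio (n : ℕ) : ∀ {α β : ℝ}, -1 < α → -1 < β →
    ((n : ℝ) + 2) * (n + α + β + 2) * (2 * n + α + β + 5) * jacobiNormSq α β (n + 2)
      = (n + α + 2) * (n + β + 2) * (2 * n + α + β + 3) * jacobiNormSq α β (n + 1) := by
  induction n with
  | zero =>
    intro α β hα hβ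
    have h1 := jacobiNormSq_succ hα hβ 0
    have h2 := jacobiNormSq_succ hα hβ 1
    have h3 := jacobiNormSq_succ (α := α + 1) (β := β + 1) (by linarith) (by linarith) 0
    have h4 := jacobiNormSq_zero_add_one (α := α + 1) (β := β + 1) (by linarith) (by linarith)
    norm_num at h1 h2 h3 h4 ⊢
    linear_combination (α + β + 2) * (α + β + 5) / 4 * h2
      + (α + β + 2) * (α + β + 3) * (α + β + 5) / 16 * h3
      - (α + 2) * (β + 2) * (α + β + 3) / 4 * h1
      + (α + β + 2) * (α + β + 3) / 16 * h4
  | succ n ih =>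
    intro α β hα hβ
    have hn : (0 : ℝ) ≤ n := n.cast_nonneg
    have h1 := jacobiNormSq_succ hα hβ (n + 1)
    have h2 := jacobiNormSq_succ hα hβ (n + 2)
    have h3 := ih (α := α + 1) (β := β + 1) (by linarith) (by linarith)
    push_cast at h1 h2 h3 ⊢
    have hp : (n : ℝ) + 2 ≠ 0 := by positivity
    refine mul_left_cancel₀ hp ?_
    linear_combination ((n : ℝ) + 2) * (n + α + β + 3) * (2 * n + α + β + 7) / 4 * h2
      + ((n : ℝ) + α + β + 3) / 4 * h3
      - ((n : ℝ) + α + 3) * (n + β + 3) * (2 * n + α + β + 5) / 4 * h1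

/-! ### Growth of the values at the endpoints -/

/-- Growth of a quotient of two rising factorials, from Euler's limit formula for `Γ`. -/
theorem isBigO_prod_range_div {x y : ℝ} (hx : 0 < x) (hy : 0 < y) :
    (fun n : ℕ => ∏ j ∈ Finset.range (n + 1), (x + j) / (y + j))
      =O[atTop] fun n : ℕ => (n : ℝ) ^ (x - y) := by
  have h1 : (fun n : ℕ => Real.GammaSeq y n / Real.GammaSeq x n) =O[atTop] fun _ => (1 : ℝ) :=
    ((Real.GammaSeq_tendsto_Gamma y).div (Real.GammaSeq_tendsto_Gamma x)
      (Real.Gamma_pos_of_pos hx).ne').isBigO_one ℝ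
  have h2 := h1.mul (Asymptotics.isBigO_refl (fun n : ℕ => (n : ℝ) ^ (x - y)) atTop)
  simp only [one_mul] at h2
  refine h2.congr' ?_ EventuallyEq.rfl
  filter_upwards [eventually_ge_atTop 1] with n hn
  have hn0 : (0 : ℝ) < n := by exact_mod_cast hn
  have hf : (n.factorial : ℝ) ≠ 0 := by positivity
  have hX : ∏ j ∈ Finset.range (n + 1), (x + j) ≠ 0 :=
    Finset.prod_ne_zero_iff.2 fun j _ => by positivity
  have hY : ∏ j ∈ Finset.range (n + 1), (y + j) ≠ 0 :=
    Finset.prod_ne_zero_iff.2 fun j _ => by positivity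
  have hnx : (n : ℝ) ^ x ≠ 0 := (Real.rpow_pos_of_pos hn0 _).ne'
  have hny : (n : ℝ) ^ y ≠ 0 := (Real.rpow_pos_of_pos hn0 _).ne'
  rw [Real.GammaSeq, Real.GammaSeq, Finset.prod_div_distrib, Real.rpow_sub hn0]
  field_simp

/-- A positive sequence with the ratios of the squared norms of the Jacobi polynomials controls
their squared values at `1`. The relation is symmetric in `α` and `β`, so that the lemma also
applies to the values at `-1`. -/
theorem exists_eval_one_sq_le {α β : ℝ} (hα : -1 < α) (hβ : -1 < β) {H : ℕ → ℝ}
    (hH : ∀ n, 0 < H n)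
    (hr : ∀ n : ℕ, ((n : ℝ) + 2) * (n + α + β + 2) * (2 * n + α + β + 5) * H (n + 2)
      = (n + α + 2) * (n + β + 2) * (2 * n + α + β + 3) * H (n + 1)) :
    ∃ C, ∀ n : ℕ, (jacobiP α β n).eval 1 ^ 2 ≤ C * H n * ((n : ℝ) + 1) ^ (2 * α + 1) := by
  set p : ℕ → ℝ := fun n => (jacobiP α β n).eval 1 ^ 2 / H n with hp
  -- The products start at degree `1`, so that `α + 2`, `β + 2` and `α + β + 2` are positive.
  have hclosed : ∀ m : ℕ, p (m + 2) = p 1 / (α + β + 3) * (2 * m + α + β + 5)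
      * ((∏ j ∈ Finset.range (m + 1), (α + 2 + j) / (2 + j))
        * ∏ j ∈ Finset.range (m + 1), (α + β + 2 + j) / (β + 2 + j)) := by
    have hstep : ∀ m : ℕ, p (m + 2) * (2 * m + α + β + 3) = p (m + 1) * (2 * m + α + β + 5)
        * ((α + 2 + m) / (2 + m) * ((α + β + 2 + m) / (β + 2 + m))) := by
      intro m
      have hm : (0 : ℝ) ≤ m := m.cast_nonneg
      have e1 := eval_one_jacobiP_succ α β (m + 1)
      have e2 := hr m
      have i1 : (2 + (m : ℝ)) ≠ 0 := by positivity
      have i2 : β + 2 + (m : ℝ) ≠ 0 := by linarith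
      have i3 := (hH (m + 1)).ne'
      have i4 := (hH (m + 2)).ne'
      have i5 : α + 2 + (m : ℝ) ≠ 0 := by linarith
      have e1' : (jacobiP α β (m + 2)).eval 1
          = (α + 2 + m) / (2 + m) * (jacobiP α β (m + 1)).eval 1 := by
        push_cast at e1
        field_simp
        linear_combination e1
      simp only [hp, e1']
      field_simp
      linear_combination (-(jacobiP α β (m + 1)).eval 1 ^ 2) * e2
    intro m
    induction m with
    | zero =>
      have := hstep 0
      have i : α + β + 3 ≠ 0 := by linarith
      simp at this ⊢
      field_simp at this ⊢
      linear_combination this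
    | succ m ih =>
      have hm : (0 : ℝ) ≤ m := m.cast_nonneg
      have h1 := hstep (m + 1)
      rw [show m + 1 + 1 = m + 2 from rfl, ih] at h1
      have i : 2 * (m : ℝ) + α + β + 5 ≠ 0 := by linarith
      refine mul_right_cancel₀ i ?_
      rw [Finset.prod_range_succ _ (m + 1), Finset.prod_range_succ _ (m + 1)]
      push_cast at h1 ⊢
      linear_combination h1
  have hbig : (fun m : ℕ => p (m + 2)) =O[atTop]
      fun m : ℕ => ((m + 2 : ℕ) + 1 : ℝ) ^ (2 * α + 1) := by
    have b1 := isBigO_prod_range_div (x := α + 2) (y := 2) (by linarith) (by norm_num)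
    have b2 := isBigO_prod_range_div (x := α + β + 2) (y := β + 2) (by linarith) (by linarith)
    have b3 : (fun m : ℕ => p 1 / (α + β + 3) * (2 * m + α + β + 5)) =O[atTop]
        fun m : ℕ => (m : ℝ) := by
      refine Asymptotics.IsBigO.const_mul_left ?_ _
      refine Asymptotics.IsBigO.of_bound (2 + |α + β + 5|) ?_
      filter_upwards [eventually_ge_atTop 1] with m hm
      have hm1 : (1 : ℝ) ≤ m := by exact_mod_cast hm
      rw [Real.norm_of_nonneg (by linarith), Real.norm_of_nonneg (by linarith)]
      nlinarith [le_abs_self (α + β + 5), abs_nonneg (α + β + 5)]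
    have b4 : (fun m : ℕ => (m : ℝ) ^ (2 * α + 1)) =O[atTop]
        fun m : ℕ => ((m + 2 : ℕ) + 1 : ℝ) ^ (2 * α + 1) := by
      have hdiv : Tendsto (fun m : ℕ => ((m : ℝ) / ((m + 2 : ℕ) + 1 : ℝ)) ^ (2 * α + 1)) atTop
          (𝓝 (1 ^ (2 * α + 1))) := by
        refine Tendsto.rpow_const ?_ (Or.inl one_ne_zero)
        simpa [add_assoc] using tendsto_natCast_div_add_atTop (𝕜 := ℝ) (2 + 1)
      refine Asymptotics.isBigO_of_div_tendsto_nhds ?_ _ (hdiv.congr fun m => ?_)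
      · exact Eventually.of_forall fun m h => absurd h (Real.rpow_pos_of_pos (by positivity) _).ne'
      · exact Real.div_rpow (by positivity) (by positivity) _
    refine Asymptotics.IsBigO.trans ?_ b4
    have b5 := b3.mul (b1.mul b2)
    refine b5.congr' ?_ ?_
    · exact Eventually.of_forall fun m => (hclosed m).symm
    · filter_upwards [eventually_ge_atTop 1] with m hm
      have hm0 : (0 : ℝ) < m := by exact_mod_cast hm
      rw [← Real.rpow_add hm0]
      nth_rewrite 1 [← Real.rpow_one (m : ℝ)]
      rw [← Real.rpow_add hm0]
      congr 1
      ring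
  have hbig' : p =O[atTop] fun n : ℕ => ((n : ℝ) + 1) ^ (2 * α + 1) := by
    rw [← map_add_atTop_eq_nat 2, Asymptotics.isBigO_map]
    exact hbig
  obtain ⟨C, -, hC⟩ := Asymptotics.bound_of_isBigO_nat_atTop hbig'
  refine ⟨C, fun n => ?_⟩
  have hpos : (0 : ℝ) < ((n : ℝ) + 1) ^ (2 * α + 1) := Real.rpow_pos_of_pos (by positivity) _
  have h := (le_abs_self _).trans (hC hpos.ne')
  rw [Real.norm_of_nonneg hpos.le] at h
  simp only [hp] at h
  rw [div_le_iff₀ (hH n)] at h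
  linarith

/-! ### The uniform bound for orthonormal Jacobi polynomials -/

/-- Sonin's function `λ y² + (1 - t²) y'²` of the Jacobi polynomial `y` of degree `n`, where
`λ = n (n + α + β + 1)` is the eigenvalue in the differential equation. -/
noncomputable def jacobiSonin (α β : ℝ) (n : ℕ) (t : ℝ) : ℝ :=
  (n : ℝ) * (n + α + β + 1) * (jacobiP α β n).eval t ^ 2
    + (1 - t ^ 2) * (jacobiP α β n).derivative.eval t ^ 2

open Polynomial in
theorem hasDerivAt_jacobiSonin (α β : ℝ) (n : ℕ) (t : ℝ) :
    HasDerivAt (jacobiSonin α β n)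
      (2 * (α - β + (α + β + 1) * t) * (jacobiP α β n).derivative.eval t ^ 2) t := by
  have d0 := ((jacobiP α β n).hasDerivAt t).pow 2
  have d1 := ((jacobiP α β n).derivative.hasDerivAt t).pow 2
  have d2 := ((hasDerivAt_id t).pow 2).const_sub 1
  refine ((d0.const_mul ((n : ℝ) * (n + α + β + 1))).add (d2.mul d1)).congr_deriv ?_
  have ho := congrArg (Polynomial.eval t) (jacobiP_ode n α β)
  simp only [eval_add, eval_mul, eval_sub, eval_pow, eval_X, eval_one, eval_C, eval_zero] at ho
  simp only [id, Pi.pow_apply]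
  push_cast
  linear_combination 2 * (jacobiP α β n).derivative.eval t * ho

theorem continuous_jacobiSonin (α β : ℝ) (n : ℕ) : Continuous (jacobiSonin α β n) :=
  continuous_iff_continuousAt.2 fun t => (hasDerivAt_jacobiSonin α β n t).continuousAt

theorem jacobiSonin_le_of_nonneg {α β : ℝ} {n : ℕ} {a b : ℝ} (hab : a ≤ b)
    (h : ∀ x ∈ Set.Icc a b, 0 ≤ α - β + (α + β + 1) * x) :
    jacobiSonin α β n a ≤ jacobiSonin α β n b := by
  refine monotoneOn_of_deriv_nonneg (convex_Icc a b) (continuous_jacobiSonin α β n).continuousOn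
    (fun x _ => (hasDerivAt_jacobiSonin α β n x).differentiableAt.differentiableWithinAt) ?_
    (Set.left_mem_Icc.2 hab) (Set.right_mem_Icc.2 hab) hab
  intro x hx
  rw [(hasDerivAt_jacobiSonin α β n x).deriv]
  have := h x (interior_subset hx)
  positivity

theorem jacobiSonin_ge_of_nonpos {α β : ℝ} {n : ℕ} {a b : ℝ} (hab : a ≤ b)
    (h : ∀ x ∈ Set.Icc a b, α - β + (α + β + 1) * x ≤ 0) :
    jacobiSonin α β n b ≤ jacobiSonin α β n a := by
  refine antitoneOn_of_deriv_nonpos (convex_Icc a b) (continuous_jacobiSonin α β n).continuousOn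
    (fun x _ => (hasDerivAt_jacobiSonin α β n x).differentiableAt.differentiableWithinAt) ?_
    (Set.left_mem_Icc.2 hab) (Set.right_mem_Icc.2 hab) hab
  intro x hx
  rw [(hasDerivAt_jacobiSonin α β n x).deriv]
  have := h x (interior_subset hx)
  exact mul_nonpos_of_nonpos_of_nonneg (by linarith) (sq_nonneg _)

theorem jacobi_eigenvalue_pos {α β : ℝ} (hα : -1 < α) (hβ : -1 < β) {n : ℕ} (hn : n ≠ 0) :
    0 < (n : ℝ) * (n + α + β + 1) := by
  have : (1 : ℝ) ≤ n := by exact_mod_cast Nat.one_le_iff_ne_zero.2 hn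
  exact mul_pos (by linarith) (by linarith)

theorem eigenvalue_mul_sq_le_jacobiSonin (α β : ℝ) (n : ℕ) {t : ℝ} (ht : t ∈ Set.Icc (-1 : ℝ) 1) :
    (n : ℝ) * (n + α + β + 1) * (jacobiP α β n).eval t ^ 2 ≤ jacobiSonin α β n t := by
  have : 0 ≤ 1 - t ^ 2 := by nlinarith [ht.1, ht.2]
  unfold jacobiSonin
  nlinarith [mul_nonneg this (sq_nonneg ((jacobiP α β n).derivative.eval t))]

/-- If one of the parameters is at least `-1/2`, Jacobi polynomials are largest at an endpoint. -/
theorem jacobiP_sq_le_endpoints {α β : ℝ} (hα : -1 < α) (hβ : -1 < β) (hm : -(1 / 2) ≤ max α β)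
    (n : ℕ) {t : ℝ} (ht : t ∈ Set.Icc (-1 : ℝ) 1) :
    (jacobiP α β n).eval t ^ 2 ≤ max ((jacobiP α β n).eval 1 ^ 2) ((jacobiP α β n).eval (-1) ^ 2) := by
  rcases eq_or_ne n 0 with rfl | hn
  · simp [jacobiP]
  have hl := jacobi_eigenvalue_pos hα hβ hn
  -- The linear factor `α - β + (α + β + 1) x` is `2 α + 1` at `1` and `-(2 β + 1)` at `-1`.
  have hsign : (∀ x ∈ Set.Icc t 1, 0 ≤ α - β + (α + β + 1) * x) ∨
      (∀ x ∈ Set.Icc (-1) t, α - β + (α + β + 1) * x ≤ 0) := by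
    obtain ⟨ht1, ht2⟩ := ht
    rcases le_or_gt (-(1 / 2)) α with h1 | h1 <;> rcases le_or_gt (-(1 / 2)) β with h2 | h2
    · rcases le_total 0 (α - β + (α + β + 1) * t) with h | h
      · exact Or.inl fun x hx => by nlinarith [hx.1]
      · exact Or.inr fun x hx => by nlinarith [hx.2]
    · exact Or.inl fun x hx => by nlinarith [hx.1, hx.2]
    · exact Or.inr fun x hx => by nlinarith [hx.1, hx.2]
    · exact absurd hm (not_le.2 (max_lt h1 h2))
  have h0 := eigenvalue_mul_sq_le_jacobiSonin α β n ht
  rcases hsign with h | h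
  · have h1 := jacobiSonin_le_of_nonneg (n := n) ht.2 h
    have h2 : jacobiSonin α β n 1 = (n : ℝ) * (n + α + β + 1) * (jacobiP α β n).eval 1 ^ 2 := by
      simp [jacobiSonin]
    exact le_max_of_le_left (le_of_mul_le_mul_left (h0.trans (h1.trans h2.le)) hl)
  · have h1 := jacobiSonin_ge_of_nonpos (n := n) ht.1 h
    have h2 : jacobiSonin α β n (-1) = (n : ℝ) * (n + α + β + 1) * (jacobiP α β n).eval (-1) ^ 2 := by
      simp [jacobiSonin]
    exact le_max_of_le_right (le_of_mul_le_mul_left (h0.trans (h1.trans h2.le)) hl)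

theorem jacobiMeasure_Icc_pos (α β : ℝ) {a b : ℝ} (ha : -1 ≤ a) (hab : a < b) (hb : b ≤ 1) :
    0 < jacobiMeasure α β (Set.Icc a b) := by
  rw [pos_iff_ne_zero, jacobiMeasure_eq_Ioo]
  intro h
  have hac : (volume.restrict (Set.Ioo (-1 : ℝ) 1)) ≪ _ :=
    withDensity_absolutelyContinuous' (f := fun t => ENNReal.ofReal (jacobiWeight α β t))
      (measurable_jacobiWeight α β).ennreal_ofReal.aemeasurable (by
        filter_upwards [ae_restrict_mem measurableSet_Ioo] with t ht
        simpa using jacobiWeight_pos α β ht)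
  have h1 := hac h
  rw [Measure.restrict_congr_set Ioo_ae_eq_Icc, Measure.restrict_apply measurableSet_Icc,
    Set.inter_eq_left.2 (Set.Icc_subset_Icc ha hb), Real.volume_Icc] at h1
  simp at h1
  linarith

theorem integral_jacobiSonin {α β : ℝ} (hα : -1 < α) (hβ : -1 < β) (n : ℕ) :
    ∫ t, jacobiSonin α β n t ∂jacobiMeasure α β
      = 2 * ((n : ℝ) * (n + α + β + 1)) * jacobiNormSq α β n := by
  unfold jacobiSonin
  rw [integral_add (integrable_jacobiMeasure hα hβ (by fun_prop))
    (integrable_jacobiMeasure hα hβ (by fun_prop)), integral_const_mul,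
    integral_one_sub_sq_mul_derivative_sq hα hβ, ← jacobiNormSq]
  ring

/-- If both parameters are below `-1/2`, Sonin's function is largest at an interior point which
does not depend on `n`, and it stays comparable to its maximum on a fixed neighbourhood of that
point. Integrating it bounds the maximum by the norm, without asymptotic formulas. -/
theorem exists_jacobiP_sq_le_of_lt {α β : ℝ} (hα : -1 < α) (hβ : -1 < β) (hα' : α < -(1 / 2))
    (hβ' : β < -(1 / 2)) :
    ∃ K, ∀ n : ℕ, ∀ t ∈ Set.Icc (-1 : ℝ) 1,
      (jacobiP α β n).eval t ^ 2 ≤ K * jacobiNormSq α β n := by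
  have := isFiniteMeasure_jacobiMeasure hα hβ
  have hs : α + β + 1 < 0 := by linarith
  set x₀ := (β - α) / (α + β + 1) with hx₀
  have hz : (α + β + 1) * x₀ = β - α := mul_div_cancel₀ _ hs.ne
  have hx1 : x₀ < 1 := by rw [hx₀, div_lt_one_of_neg hs]; linarith
  have hx2 : -1 < x₀ := by rw [hx₀, lt_div_iff_of_neg hs]; linarith
  -- `κ` bounds `1 - y²` from below on `[x₀, (x₀ + 1) / 2]`, whence `|g'| ≤ 4 G / κ` for Sonin's
  -- function `g` with maximum `G`; on an interval of length `κ / 8` it loses at most `G / 2`.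
  set κ := (1 - (x₀ + 1) / 2) * (1 + x₀) with hκ
  have hκ0 : 0 < κ := mul_pos (by linarith) (by linarith)
  set x₁ := min ((x₀ + 1) / 2) (x₀ + κ / 8) with hx₁
  have h01 : x₀ < x₁ := lt_min (by linarith) (by linarith)
  have h11 : x₁ ≤ (x₀ + 1) / 2 := min_le_left _ _
  have h12 : x₁ ≤ x₀ + κ / 8 := min_le_right _ _
  set m := (jacobiMeasure α β).real (Set.Icc x₀ x₁) with hm
  have hm0 : 0 < m :=
    ENNReal.toReal_pos (jacobiMeasure_Icc_pos α β hx2.le h01 (by linarith)).ne' (measure_ne_top _ _)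
  refine ⟨max (4 / m) (jacobiNormSq α β 0)⁻¹, fun n t ht => ?_⟩
  have hH := jacobiNormSq_pos n hα hβ
  rcases eq_or_ne n 0 with rfl | hn
  · calc (jacobiP α β 0).eval t ^ 2 = (jacobiNormSq α β 0)⁻¹ * jacobiNormSq α β 0 := by
          rw [inv_mul_cancel₀ hH.ne']; simp [jacobiP]
      _ ≤ _ := by gcongr; exact le_max_right _ _
  have hl := jacobi_eigenvalue_pos hα hβ hn
  set G := jacobiSonin α β n x₀ with hG
  have hnn : ∀ x ∈ Set.Icc (-1 : ℝ) 1, 0 ≤ jacobiSonin α β n x := fun x hx =>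
    (mul_nonneg hl.le (sq_nonneg _)).trans (eigenvalue_mul_sq_le_jacobiSonin α β n hx)
  have hG0 : 0 ≤ G := hnn x₀ ⟨hx2.le, hx1.le⟩
  have hmax : ∀ x ∈ Set.Icc (-1 : ℝ) 1, jacobiSonin α β n x ≤ G := by
    intro x hx
    rcases le_total x x₀ with h | h
    · exact jacobiSonin_le_of_nonneg h fun y hy => by nlinarith [hy.2]
    · exact jacobiSonin_ge_of_nonpos h fun y hy => by nlinarith [hy.1]
  have hlow : ∀ x ∈ Set.Icc x₀ x₁, G / 2 ≤ jacobiSonin α β n x := by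
    intro x hx
    have hb : ∀ y ∈ Set.Icc x₀ x₁, ‖2 * (α - β + (α + β + 1) * y)
        * (jacobiP α β n).derivative.eval y ^ 2‖ ≤ 4 * G / κ := by
      intro y hy
      have hyI : y ∈ Set.Icc (-1 : ℝ) 1 := ⟨by linarith [hy.1], by linarith [hy.2]⟩
      have h1 : κ ≤ 1 - y ^ 2 := by
        have : κ ≤ (1 - y) * (1 + y) :=
          mul_le_mul (by linarith [hy.2]) (by linarith [hy.1]) (by linarith) (by linarith [hyI.2])
        linarith
      have h2 : κ * (jacobiP α β n).derivative.eval y ^ 2 ≤ G := by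
        refine le_trans ?_ (hmax y hyI)
        unfold jacobiSonin
        nlinarith [mul_nonneg hl.le (sq_nonneg ((jacobiP α β n).eval y)),
          mul_le_mul_of_nonneg_right h1 (sq_nonneg ((jacobiP α β n).derivative.eval y))]
      have h3 : |2 * (α - β + (α + β + 1) * y)| ≤ 4 := by
        rw [abs_le]
        constructor <;> nlinarith [hyI.1, hyI.2]
      rw [Real.norm_eq_abs, abs_mul, abs_of_nonneg (sq_nonneg (Polynomial.eval y _)),
        le_div_iff₀ hκ0]
      calc _ ≤ 4 * (jacobiP α β n).derivative.eval y ^ 2 * κ := by gcongr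
        _ ≤ 4 * G := by linarith
    have hd := (convex_Icc x₀ x₁).norm_image_sub_le_of_norm_hasDerivWithin_le
      (fun y _ => (hasDerivAt_jacobiSonin α β n y).hasDerivWithinAt) hb
      (Set.left_mem_Icc.2 h01.le) hx
    rw [Real.norm_eq_abs, Real.norm_eq_abs, abs_of_nonneg (sub_nonneg.2 hx.1)] at hd
    have h4 : 4 * G / κ * (x - x₀) ≤ G / 2 := by
      calc 4 * G / κ * (x - x₀) ≤ 4 * G / κ * (κ / 8) := by
            gcongr
            linarith [hx.2]
        _ = G / 2 := by field_simp; ring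
    linarith [neg_abs_le (jacobiSonin α β n x - jacobiSonin α β n x₀)]
  have hint := integrable_jacobiMeasure hα hβ (continuous_jacobiSonin α β n)
  have hI : G / 2 * m ≤ 2 * ((n : ℝ) * (n + α + β + 1)) * jacobiNormSq α β n := by
    rw [← integral_jacobiSonin hα hβ n]
    calc G / 2 * m = ∫ _ in Set.Icc x₀ x₁, G / 2 ∂jacobiMeasure α β := by
          rw [setIntegral_const, smul_eq_mul, mul_comm]
      _ ≤ ∫ x in Set.Icc x₀ x₁, jacobiSonin α β n x ∂jacobiMeasure α β :=
          setIntegral_mono_on (integrable_const _) hint.integrableOn measurableSet_Icc hlow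
      _ ≤ _ := by
          refine setIntegral_le_integral hint ?_
          filter_upwards [ae_mem_Ioo_jacobiMeasure α β] with x hx
          exact hnn x (Set.Ioo_subset_Icc_self hx)
  have h5 : (jacobiP α β n).eval t ^ 2 ≤ 4 / m * jacobiNormSq α β n := by
    have h6 := (eigenvalue_mul_sq_le_jacobiSonin α β n ht).trans (hmax t ht)
    refine le_of_mul_le_mul_left ?_ hl
    rw [div_mul_eq_mul_div, mul_div_assoc', le_div_iff₀ hm0]
    nlinarith [mul_le_mul_of_nonneg_right h6 hm0.le]
  exact h5.trans (by gcongr; exact le_max_left _ _)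

theorem exists_jacobiP_sq_le {α β : ℝ} (hα : -1 < α) (hβ : -1 < β) :
    ∃ K, 0 < K ∧ ∀ n : ℕ, ∀ t ∈ Set.Icc (-1 : ℝ) 1, (jacobiP α β n).eval t ^ 2
      ≤ K * jacobiNormSq α β n * ((n : ℝ) + 1) ^ (2 * jacobiSigma α β) := by
  rcases le_or_gt (-(1 / 2)) (max α β) with hm | hm
  · obtain ⟨C₁, h₁⟩ := exists_eval_one_sq_le hα hβ (fun n => jacobiNormSq_pos n hα hβ)
      (fun n => jacobiNormSq_ratio n hα hβ)
    obtain ⟨C₂, h₂⟩ := exists_eval_one_sq_le hβ hα (fun n => jacobiNormSq_pos n hα hβ)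
      (fun n => by linear_combination jacobiNormSq_ratio n hα hβ)
    have hσ : 2 * jacobiSigma α β = 2 * max α β + 1 := by
      rw [jacobiSigma, max_eq_right (by linarith)]; ring
    refine ⟨max 1 (max C₁ C₂), by positivity, fun n t ht => ?_⟩
    have hH := (jacobiNormSq_pos n hα hβ).le
    have hn : (1 : ℝ) ≤ n + 1 := by linarith [(n.cast_nonneg : (0 : ℝ) ≤ n)]
    refine (jacobiP_sq_le_endpoints hα hβ hm n ht).trans (max_le ?_ ?_)
    · refine (h₁ n).trans ?_
      rw [hσ]
      gcongr
      · exact (le_max_left _ _).trans (le_max_right _ _)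
      · exact le_max_left _ _
    · rw [eval_neg_one_jacobiP_sq n α β hα hβ]
      refine (h₂ n).trans ?_
      rw [hσ]
      gcongr
      · exact (le_max_right _ _).trans (le_max_right _ _)
      · exact le_max_right _ _
  · obtain ⟨K, hK⟩ := exists_jacobiP_sq_le_of_lt hα hβ ((le_max_left _ _).trans_lt hm)
      ((le_max_right _ _).trans_lt hm)
    refine ⟨max 1 K, by positivity, fun n t ht => (hK n t ht).trans ?_⟩
    have hσ : jacobiSigma α β = 0 := max_eq_left (by linarith)
    rw [hσ, mul_zero, Real.rpow_zero, mul_one]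
    exact mul_le_mul_of_nonneg_right (le_max_right _ _) (jacobiNormSq_pos n hα hβ).le

theorem jacobiH_eq_sqrt (α β : ℝ) (n : ℕ) : jacobiH α β n = √(jacobiNormSq α β n) := by
  rw [Real.sqrt_eq_rpow]; rfl

/-- The uniform bound `O((n + 1)^σ)` for the orthonormal Jacobi polynomials. -/
theorem exists_abs_jacobiON_le {α β : ℝ} (hα : -1 < α) (hβ : -1 < β) :
    ∃ K, 0 < K ∧ ∀ n : ℕ, ∀ t ∈ Set.Icc (-1 : ℝ) 1,
      |jacobiON α β n t| ≤ K * ((n : ℝ) + 1) ^ jacobiSigma α β := by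
  obtain ⟨K, hK, h⟩ := exists_jacobiP_sq_le hα hβ
  refine ⟨√K, Real.sqrt_pos.2 hK, fun n t ht => abs_le_of_sq_le_sq ?_ (by positivity)⟩
  have hH := jacobiNormSq_pos n hα hβ
  have hn : (0 : ℝ) < (n : ℝ) + 1 := by positivity
  rw [jacobiON, jacobiH_eq_sqrt, mul_pow, mul_pow, inv_pow, Real.sq_sqrt hH.le, Real.sq_sqrt hK.le,
    ← Real.rpow_natCast (((n : ℝ) + 1) ^ jacobiSigma α β), ← Real.rpow_mul hn.le,
    inv_mul_le_iff₀ hH]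
  have := h n t ht
  rw [mul_comm (2 : ℝ)] at this
  push_cast
  linarith

theorem continuous_jacobiON (α β : ℝ) (n : ℕ) : Continuous (jacobiON α β n) := by
  unfold jacobiON
  fun_prop

theorem integral_jacobiON_mul_jacobiON {α β : ℝ} (hα : -1 < α) (hβ : -1 < β) (m n : ℕ) :
    ∫ t, jacobiON α β m t * jacobiON α β n t ∂jacobiMeasure α β = if m = n then 1 else 0 := by
  have he : ∀ t, jacobiON α β m t * jacobiON α β n t = ((jacobiH α β m)⁻¹ * (jacobiH α β n)⁻¹)
      * ((jacobiP α β m).eval t * (jacobiP α β n).eval t) := by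
    intro t; unfold jacobiON; ring
  simp only [he]
  rw [integral_const_mul]
  split_ifs with h
  · subst h
    have hH := jacobiNormSq_pos m hα hβ
    simp only [← pow_two]
    rw [← jacobiNormSq, jacobiH_eq_sqrt, inv_pow, Real.sq_sqrt hH.le, inv_mul_cancel₀ hH.ne']
  · rw [integral_jacobiP_mul_jacobiP hα hβ h, mul_zero]

/-! ### Auxiliary inequalities for the interpolation argument -/

theorem lintegral_Ioc_rpow {r c : ℝ} (hr : -1 < r) (hc : 0 ≤ c) :
    ∫⁻ t in Set.Ioc 0 c, ENNReal.ofReal (t ^ r) = ENNReal.ofReal (c ^ (r + 1) / (r + 1)) := by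
  have hi : IntegrableOn (fun t : ℝ => t ^ r) (Set.Ioc 0 c) :=
    (intervalIntegrable_iff_integrableOn_Ioc_of_le hc).1 (intervalIntegral.intervalIntegrable_rpow' hr)
  rw [← ofReal_integral_eq_lintegral_ofReal hi, ← intervalIntegral.integral_of_le hc,
    integral_rpow (Or.inl hr), Real.zero_rpow (by linarith), sub_zero]
  filter_upwards [ae_restrict_mem measurableSet_Ioc] with t ht
  exact Real.rpow_nonneg ht.1.le _

theorem lintegral_Ioi_rpow {r c : ℝ} (hr : r < -1) (hc : 0 < c) :
    ∫⁻ t in Set.Ioi c, ENNReal.ofReal (t ^ r) = ENNReal.ofReal (c ^ (r + 1) / -(r + 1)) := by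
  rw [← ofReal_integral_eq_lintegral_ofReal (integrableOn_Ioi_rpow_of_lt hr hc),
    integral_Ioi_rpow_of_lt hr hc, div_neg, neg_div]
  filter_upwards [ae_restrict_mem measurableSet_Ioi] with t ht
  exact Real.rpow_nonneg (hc.trans ht).le _

/-- The layer cake estimate behind the weak type `(1, 1)` bound in Paley's inequality. -/
theorem sum_sq_mul_le_of_lt {ι : Type*} (F : Finset ι) {ω ν : ι → ℝ} {M A : ℝ}
    (hω : ∀ n ∈ F, 0 < ω n) (hν : ∀ n ∈ F, 0 ≤ ν n)
    (hM : ∀ t > 0, t * ∑ n ∈ F with t ≤ ω n, ν n ≤ M) (hA : 0 ≤ A) :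
    ∑ n ∈ F with ω n < A, ω n ^ 2 * ν n ≤ 2 * A * M := by
  have hint : ∀ n, IntervalIntegrable
      (fun t : ℝ => (Set.Iic (ω n)).indicator (fun t => 2 * t) t * ν n) volume 0 A := by
    intro n
    refine IntervalIntegrable.mul_const ?_ _
    rw [intervalIntegrable_iff]
    exact IntegrableOn.indicator ((by fun_prop : Continuous fun t : ℝ => 2 * t).integrableOn_uIoc)
      measurableSet_Iic
  -- `ω² = ∫ 2 t` over `0 < t ≤ ω`; exchanging sum and integral leaves `2 t ∑ ν ≤ 2 M`.
  have hsq : ∀ n ∈ F.filter (fun n => ω n < A), ω n ^ 2 * ν n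
      = ∫ t in 0..A, (Set.Iic (ω n)).indicator (fun t => 2 * t) t * ν n := by
    intro n hn
    obtain ⟨hnF, hn⟩ := Finset.mem_filter.1 hn
    rw [intervalIntegral.integral_mul_const, intervalIntegral.integral_of_le hA,
      setIntegral_indicator measurableSet_Iic, Set.Ioc_inter_Iic, min_eq_right hn.le,
      ← intervalIntegral.integral_of_le (hω n hnF).le, intervalIntegral.integral_const_mul,
      integral_id]
    ring
  rw [Finset.sum_congr rfl hsq, ← intervalIntegral.integral_finsetSum fun n _ => hint n]
  calc _ ≤ ∫ _ in 0..A, 2 * M := by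
        refine intervalIntegral.integral_mono_on_of_le_Ioo hA ?_ (by simp) fun t ht => ?_
        · simpa only [Finset.sum_apply] using
            (IntervalIntegrable.sum (F.filter fun n => ω n < A) fun n _ => hint n).congr
              (g := fun t => ∑ n ∈ F with ω n < A,
                (Set.Iic (ω n)).indicator (fun t => 2 * t) t * ν n)
              fun t _ => by simp only [Finset.sum_apply]
        have hnn : ∀ n ∈ F, 0 ≤ (Set.Iic (ω n)).indicator (fun t => 2 * t) t * ν n := fun n hn =>
          mul_nonneg (Set.indicator_apply_nonneg fun _ => by linarith [ht.1]) (hν n hn)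
        calc _ ≤ ∑ n ∈ F, (Set.Iic (ω n)).indicator (fun t => 2 * t) t * ν n :=
              Finset.sum_le_sum_of_subset_of_nonneg (Finset.filter_subset _ _)
                fun n hn _ => hnn n hn
          _ = 2 * (t * ∑ n ∈ F with t ≤ ω n, ν n) := by
              rw [Finset.sum_filter, Finset.mul_sum, Finset.mul_sum]
              refine Finset.sum_congr rfl fun n _ => ?_
              by_cases h : t ≤ ω n
              · simp [h, mul_assoc]
              · simp [h]
          _ ≤ 2 * M := by linarith [hM t ht.1]
    _ = 2 * A * M := by
        rw [intervalIntegral.integral_const, smul_eq_mul]; ring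

/-- The integrand which remains when the two truncation estimates in Marcinkiewicz' argument are
inserted in the layer cake formula: `t` is the level, `u` the modulus of the function, and the
function is cut at height `a t`. -/
noncomputable def truncKernel (p a A B t u : ℝ) : ℝ :=
  if a * t ≤ u then A * t ^ (p - 2) * u else B * t ^ (p - 3) * u ^ 2

theorem lintegral_truncKernel {p a A B u : ℝ} (hp : 1 < p) (hp2 : p < 2) (ha : 0 < a) (hA : 0 ≤ A)
    (hB : 0 ≤ B) (hu : 0 ≤ u) :
    ∫⁻ t in Set.Ioi (0 : ℝ), ENNReal.ofReal (truncKernel p a A B t u)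
      = ENNReal.ofReal ((A / (p - 1) * a ^ (1 - p) + B / (2 - p) * a ^ (2 - p)) * u ^ p) := by
  rcases hu.eq_or_lt with rfl | hu
  · simp [truncKernel, Real.zero_rpow (show p ≠ 0 by linarith)]
  have hc : 0 < u / a := div_pos hu ha
  rw [← Set.Ioc_union_Ioi_eq_Ioi hc.le, lintegral_union measurableSet_Ioi
    (Set.Ioc_disjoint_Ioi le_rfl)]
  have h1 : ∫⁻ t in Set.Ioc 0 (u / a), ENNReal.ofReal (truncKernel p a A B t u)
      = ∫⁻ t in Set.Ioc 0 (u / a), ENNReal.ofReal (A * u) * ENNReal.ofReal (t ^ (p - 2)) := by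
    refine setLIntegral_congr_fun measurableSet_Ioc fun t ht => ?_
    have : a * t ≤ u := by rw [mul_comm]; exact (le_div_iff₀ ha).1 ht.2
    simp only [truncKernel, if_pos this]
    rw [← ENNReal.ofReal_mul (by positivity)]
    congr 1; ring
  have h2 : ∫⁻ t in Set.Ioi (u / a), ENNReal.ofReal (truncKernel p a A B t u)
      = ∫⁻ t in Set.Ioi (u / a), ENNReal.ofReal (B * u ^ 2) * ENNReal.ofReal (t ^ (p - 3)) := by
    refine setLIntegral_congr_fun measurableSet_Ioi fun t ht => ?_
    have : ¬ a * t ≤ u := by rw [not_le, mul_comm]; exact (div_lt_iff₀ ha).1 ht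
    simp only [truncKernel, if_neg this]
    rw [← ENNReal.ofReal_mul (by positivity)]
    congr 1; ring
  rw [h1, h2, lintegral_const_mul _ (by fun_prop), lintegral_const_mul _ (by fun_prop),
    lintegral_Ioc_rpow (by linarith) hc.le, lintegral_Ioi_rpow (by linarith) hc,
    ← ENNReal.ofReal_mul (by positivity), ← ENNReal.ofReal_mul (by positivity),
    ← ENNReal.ofReal_add]
  · congr 1
    rw [Real.div_rpow hu.le ha.le, Real.div_rpow hu.le ha.le]
    have e1 : u ^ p = u * u ^ (p - 2 + 1) := by
      rw [← Real.rpow_one_add' hu.le (by linarith)]; congr 1; ring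
    have e2 : u ^ p = u ^ 2 * u ^ (p - 3 + 1) := by
      rw [← Real.rpow_natCast, ← Real.rpow_add hu]; congr 1; push_cast; ring
    have e3 : a ^ (1 - p) = (a ^ (p - 2 + 1))⁻¹ := by rw [← Real.rpow_neg ha.le]; congr 1; ring
    have e4 : a ^ (2 - p) = (a ^ (p - 3 + 1))⁻¹ := by rw [← Real.rpow_neg ha.le]; congr 1; ring
    have i1 : p - 2 + 1 = p - 1 := by ring
    have i2 : -(p - 3 + 1) = 2 - p := by ring
    rw [add_mul, e3, e4]
    nth_rewrite 1 [e1]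
    rw [e2, i2, i1]
    ring
  · have : 0 < p - 2 + 1 := by linarith
    positivity
  · have : 0 < -(p - 3 + 1) := by linarith
    positivity

/-- Hölder's inequality in logarithmically convex form, the degenerate exponents included. -/
theorem sum_rpow_mul_rpow_le {ι : Type*} (F : Finset ι) {a b : ι → ℝ} {η : ℝ}
    (ha : ∀ n ∈ F, 0 ≤ a n) (hb : ∀ n ∈ F, 0 ≤ b n) (h0 : 0 ≤ η) (h1 : η ≤ 1) :
    ∑ n ∈ F, a n ^ η * b n ^ (1 - η) ≤ (∑ n ∈ F, a n) ^ η * (∑ n ∈ F, b n) ^ (1 - η) := by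
  rcases h0.eq_or_lt with rfl | h0
  · simp
  rcases h1.eq_or_lt with rfl | h1
  · simp
  have hpq : (1 / η).HolderConjugate (1 / (1 - η)) := by
    rw [Real.holderConjugate_iff]
    refine ⟨by rw [lt_div_iff₀ h0]; linarith, by simp⟩
  refine (Real.inner_le_Lp_mul_Lq_of_nonneg F hpq (fun n hn => Real.rpow_nonneg (ha n hn) _)
    fun n hn => Real.rpow_nonneg (hb n hn) _).trans (le_of_eq ?_)
  have h1' : 1 - η ≠ 0 := by linarith
  congr 2
  · refine Finset.sum_congr rfl fun n hn => ?_
    rw [← Real.rpow_mul (ha n hn), mul_one_div_cancel h0.ne', Real.rpow_one]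
  · simp
  · refine Finset.sum_congr rfl fun n hn => ?_
    rw [← Real.rpow_mul (hb n hn), mul_one_div_cancel h1', Real.rpow_one]
  · simp

/-! ### Paley and Hausdorff–Young inequalities for bounded Bessel systems -/

/-- A system of functions for which Bessel's inequality holds and whose `n`-th member is bounded by
`K d n`. -/
structure IsBesselSystem {X : Type*} [MeasurableSpace X] (μ : Measure X) (e : ℕ → X → ℝ) (d : ℕ → ℝ) (K : ℝ) : Prop where
  aestronglyMeasurable : ∀ n, AEStronglyMeasurable (e n) μ
  pos : ∀ n, 0 < d n
  const_pos : 0 < K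
  bound : ∀ n, ∀ᵐ x ∂μ, |e n x| ≤ K * d n
  bessel : ∀ g : X → ℂ, MemLp g 2 μ → ∀ F : Finset ℕ,
    ∑ n ∈ F, ‖∫ x, g x * (e n x : ℂ) ∂μ‖ ^ 2 ≤ ∫ x, ‖g x‖ ^ 2 ∂μ

namespace IsBesselSystem

variable {X : Type*} [MeasurableSpace X] {μ : Measure X} {e : ℕ → X → ℝ} {d : ℕ → ℝ} {K : ℝ}

theorem integrable_mul (h : IsBesselSystem μ e d K) {f : X → ℂ} (hf : Integrable f μ) (n : ℕ) :
    Integrable (fun x => f x * (e n x : ℂ)) μ := by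
  refine hf.mul_bdd (c := K * d n) ?_ ?_
  · exact Complex.continuous_ofReal.comp_aestronglyMeasurable (h.aestronglyMeasurable n)
  · filter_upwards [h.bound n] with x hx
    simpa using hx

theorem norm_integral_mul_le (h : IsBesselSystem μ e d K) {f : X → ℂ} (hf : Integrable f μ) (n : ℕ) :
    ‖∫ x, f x * (e n x : ℂ) ∂μ‖ ≤ K * d n * ∫ x, ‖f x‖ ∂μ := by
  rw [← integral_const_mul]
  refine norm_integral_le_of_norm_le (hf.norm.const_mul _) ?_
  filter_upwards [h.bound n] with x hx
  rw [norm_mul, mul_comm, Complex.norm_real, Real.norm_eq_abs]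
  gcongr

/-- Marcinkiewicz' truncation at height `τ`: the large part of `f` is estimated through the uniform
bound, the small part through Bessel's inequality. -/
theorem sum_level_le (h : IsBesselSystem μ e d K) [IsFiniteMeasure μ] {F : Finset ℕ} {ω : ℕ → ℝ}
    {M : ℝ} (hω : ∀ n ∈ F, 0 < ω n)
    (hM : ∀ t > 0, t * ∑ n ∈ F with t ≤ ω n, d n ^ 2 ≤ M) {f : X → ℂ} (hfm : StronglyMeasurable f)
    (hf : Integrable f μ) {t τ : ℝ} (ht : 0 < t) :
    ∑ n ∈ F with t < ‖∫ x, f x * (e n x : ℂ) ∂μ‖ / (ω n * d n), (ω n * d n) ^ 2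
      ≤ ∫ x, (if τ ≤ ‖f x‖ then 4 * K * M / t * ‖f x‖ else 4 / t ^ 2 * ‖f x‖ ^ 2) ∂μ := by
  set S := {x | τ ≤ ‖f x‖} with hS
  have hSm : MeasurableSet S := measurableSet_le measurable_const hfm.norm.measurable
  set f₁ := S.indicator f with hf₁
  set f₂ := Sᶜ.indicator f with hf₂
  have hf12 : f₁ + f₂ = f := Set.indicator_self_add_compl S f
  have hi1 : Integrable f₁ μ := hf.indicator hSm
  have hi2 : Integrable f₂ μ := hf.indicator hSm.compl
  have hb2 : ∀ x, ‖f₂ x‖ ≤ |τ| := by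
    intro x
    by_cases hx : x ∈ S
    · simp [hf₂, hx]
    · have : ‖f x‖ < τ := not_le.1 hx
      rw [hf₂, Set.indicator_of_mem (by simpa using hx)]
      exact this.le.trans (le_abs_self _)
  have hL2 : MemLp f₂ 2 μ :=
    MemLp.of_bound hi2.aestronglyMeasurable |τ| (Eventually.of_forall hb2)
  set I₁ := ∫ x, ‖f₁ x‖ ∂μ with hI₁
  set I₂ := ∫ x, ‖f₂ x‖ ^ 2 ∂μ with hI₂
  have hI₁0 : 0 ≤ I₁ := integral_nonneg fun x => norm_nonneg _
  have hrhs : ∫ x, (if τ ≤ ‖f x‖ then 4 * K * M / t * ‖f x‖ else 4 / t ^ 2 * ‖f x‖ ^ 2) ∂μ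
      = 4 * K * M / t * I₁ + 4 / t ^ 2 * I₂ := by
    rw [hI₁, hI₂, ← integral_const_mul, ← integral_const_mul, ← integral_add]
    · refine integral_congr_ae (Eventually.of_forall fun x => ?_)
      by_cases hx : τ ≤ ‖f x‖
      · have hx' : x ∈ S := hx
        simp [hx, hf₁, hf₂, hx']
      · have hx' : x ∉ S := hx
        simp [hx, hf₁, hf₂, hx']
    · exact hi1.norm.const_mul _
    · exact hL2.integrable_norm_pow (by norm_num) |>.const_mul _
  rw [hrhs]
  set c₁ : ℕ → ℝ := fun n => ‖∫ x, f₁ x * (e n x : ℂ) ∂μ‖ with hc₁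
  set c₂ : ℕ → ℝ := fun n => ‖∫ x, f₂ x * (e n x : ℂ) ∂μ‖ with hc₂
  have hc : ∀ n, ‖∫ x, f x * (e n x : ℂ) ∂μ‖ ≤ c₁ n + c₂ n := by
    intro n
    rw [← hf12]
    simp only [Pi.add_apply, add_mul]
    rw [integral_add (h.integrable_mul hi1 n) (h.integrable_mul hi2 n)]
    exact norm_add_le _ _
  -- If `t` is exceeded, then one of the two parts exceeds `t / 2`; for the large part this forces
  -- `ω n` to be small.
  have hsub : (F.filter fun n => t < ‖∫ x, f x * (e n x : ℂ) ∂μ‖ / (ω n * d n)) ⊆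
      (F.filter fun n => ω n < 2 * K * I₁ / t) ∪ (F.filter fun n => t * (ω n * d n) ≤ 2 * c₂ n) := by
    intro n hn
    obtain ⟨hnF, hn⟩ := Finset.mem_filter.1 hn
    have hωd : 0 < ω n * d n := mul_pos (hω n hnF) (h.pos n)
    rw [lt_div_iff₀ hωd] at hn
    simp only [Finset.mem_union, Finset.mem_filter, hnF, true_and]
    by_contra! hcon
    obtain ⟨hcon1, hcon2⟩ := hcon
    rw [div_le_iff₀ ht] at hcon1
    have h1 : c₁ n ≤ K * d n * I₁ := h.norm_integral_mul_le hi1 n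
    have h2 := mul_le_mul_of_nonneg_left hcon1 (h.pos n).le
    linarith [hc n]
  refine (Finset.sum_le_sum_of_subset_of_nonneg hsub fun n _ _ => sq_nonneg _).trans ?_
  refine (le_add_of_nonneg_right (Finset.sum_nonneg fun n _ => sq_nonneg _)).trans
    (Finset.sum_union_inter.le.trans (add_le_add ?_ ?_))
  · have hA : 0 ≤ 2 * K * I₁ / t := by have := h.const_pos; positivity
    simp only [mul_pow]
    refine (sum_sq_mul_le_of_lt F hω (fun n _ => sq_nonneg (d n)) hM hA).trans (le_of_eq ?_)
    ring
  · calc ∑ n ∈ F with t * (ω n * d n) ≤ 2 * c₂ n, (ω n * d n) ^ 2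
        ≤ ∑ n ∈ F with t * (ω n * d n) ≤ 2 * c₂ n, 4 / t ^ 2 * c₂ n ^ 2 := by
          refine Finset.sum_le_sum fun n hn => ?_
          obtain ⟨hnF, hn⟩ := Finset.mem_filter.1 hn
          have hωd : 0 < ω n * d n := mul_pos (hω n hnF) (h.pos n)
          have := pow_le_pow_left₀ (by positivity) hn 2
          rw [div_mul_eq_mul_div, le_div_iff₀ (by positivity)]
          linarith
      _ ≤ 4 / t ^ 2 * I₂ := by
          rw [← Finset.mul_sum]
          gcongr
          exact h.bessel f₂ hL2 _

/-- **Paley's inequality** for finite sums. It is the strong type `(p, p)` bound for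
`f ↦ |f̂ n| / (ω n d n)` with the weights `(ω n d n) ^ 2`, interpolated between the exponents `1`
and `2`. -/
theorem paley (h : IsBesselSystem μ e d K) [IsFiniteMeasure μ] {p : ℝ} (hp : 1 < p) (hp2 : p < 2)
    {F : Finset ℕ} {ω : ℕ → ℝ} {M : ℝ} (hM0 : 0 < M) (hω : ∀ n ∈ F, 0 < ω n)
    (hM : ∀ t > 0, t * ∑ n ∈ F with t ≤ ω n, d n ^ 2 ≤ M) {f : X → ℂ}
    (hf : MemLp f (ENNReal.ofReal p) μ) :
    ∑ n ∈ F, (‖∫ x, f x * (e n x : ℂ) ∂μ‖ / (ω n * d n)) ^ p * (ω n * d n) ^ 2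
      ≤ (4 * p / (p - 1) + 4 * p / (2 - p)) * (K * M) ^ (2 - p) * ∫ x, ‖f x‖ ^ p ∂μ := by
  wlog hfm : StronglyMeasurable f generalizing f
  · obtain ⟨g, hgm, hfg⟩ := hf.1
    have h1 : ∀ n, ∫ x, f x * (e n x : ℂ) ∂μ = ∫ x, g x * (e n x : ℂ) ∂μ := fun n =>
      integral_congr_ae (by filter_upwards [hfg] with x hx; rw [hx])
    have h2 : ∫ x, ‖f x‖ ^ p ∂μ = ∫ x, ‖g x‖ ^ p ∂μ :=
      integral_congr_ae (by filter_upwards [hfg] with x hx; rw [hx])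
    simp only [h1, h2]
    exact this (hf.ae_eq hfg) hgm
  have hp0 : 0 < p := by linarith
  have hK := h.const_pos
  have ha : 0 < K * M := mul_pos hK hM0
  have hi : Integrable f μ := hf.integrable (by simpa using hp.le)
  have hip : Integrable (fun x => ‖f x‖ ^ p) μ := by
    have := hf.integrable_norm_rpow (by simpa using hp0) ENNReal.ofReal_ne_top
    rwa [ENNReal.toReal_ofReal hp0.le] at this
  set b : ℕ → ℝ := fun n => ‖∫ x, f x * (e n x : ℂ) ∂μ‖ / (ω n * d n) with hb
  have hb0 : ∀ n ∈ F, 0 ≤ b n := fun n hn =>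
    div_nonneg (norm_nonneg _) (mul_pos (hω n hn) (h.pos n)).le
  have hsum0 : 0 ≤ ∑ n ∈ F, b n ^ p * (ω n * d n) ^ 2 :=
    Finset.sum_nonneg fun n hn => mul_nonneg (Real.rpow_nonneg (hb0 n hn) _) (sq_nonneg _)
  -- The cutting height `K M t` balances the two contributions.
  set k := truncKernel p (K * M) (4 * p * K * M) (4 * p) with hk
  have hkm : Measurable (Function.uncurry fun (t : ℝ) (x : X) => ENNReal.ofReal (k t ‖f x‖)) := by
    have hfx : Measurable fun z : ℝ × X => ‖f z.2‖ := hfm.norm.measurable.comp measurable_snd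
    refine Measurable.ennreal_ofReal ?_
    refine Measurable.ite (measurableSet_le (by fun_prop) hfx) ?_ ?_
    · exact (by fun_prop : Measurable fun z : ℝ × X => 4 * p * K * M * z.1 ^ (p - 2)).mul hfx
    · exact (by fun_prop : Measurable fun z : ℝ × X => 4 * p * z.1 ^ (p - 3)).mul (hfx.pow_const 2)
  have hcake : ENNReal.ofReal (∑ n ∈ F, b n ^ p * (ω n * d n) ^ 2)
      = ∫⁻ t in Set.Ioi (0 : ℝ),
        ENNReal.ofReal (p * t ^ (p - 1) * ∑ n ∈ F with t < b n, (ω n * d n) ^ 2) := by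
    have h1 : ∀ n ∈ F, ENNReal.ofReal (b n ^ p) = ∫⁻ t in Set.Ioi (0 : ℝ),
        (Set.Iio (b n)).indicator (fun t => ENNReal.ofReal (p * t ^ (p - 1))) t := by
      intro n hn
      rw [setLIntegral_indicator measurableSet_Iio, Set.Iio_inter_Ioi,
        Measure.restrict_congr_set Ioo_ae_eq_Ioc]
      simp only [ENNReal.ofReal_mul hp0.le]
      rw [lintegral_const_mul _ (by fun_prop), lintegral_Ioc_rpow (by linarith) (hb0 n hn),
        ← ENNReal.ofReal_mul hp0.le, sub_add_cancel, mul_div_cancel₀ _ hp0.ne']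
    rw [ENNReal.ofReal_sum_of_nonneg fun n hn =>
      mul_nonneg (Real.rpow_nonneg (hb0 n hn) _) (sq_nonneg _)]
    have h2 : ∀ n ∈ F, ENNReal.ofReal (b n ^ p * (ω n * d n) ^ 2) = ∫⁻ t in Set.Ioi (0 : ℝ),
        (Set.Iio (b n)).indicator (fun t => ENNReal.ofReal (p * t ^ (p - 1))) t
          * ENNReal.ofReal ((ω n * d n) ^ 2) := by
      intro n hn
      rw [lintegral_mul_const _ ((by fun_prop : Measurable fun t : ℝ =>
          ENNReal.ofReal (p * t ^ (p - 1))).indicator measurableSet_Iio), ← h1 n hn,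
        ENNReal.ofReal_mul (Real.rpow_nonneg (hb0 n hn) _)]
    rw [Finset.sum_congr rfl h2, ← lintegral_finsetSum _ fun n _ => ((by fun_prop :
      Measurable fun t : ℝ => ENNReal.ofReal (p * t ^ (p - 1))).indicator
        measurableSet_Iio).mul_const _]
    refine setLIntegral_congr_fun measurableSet_Ioi fun t ht => ?_
    have ht' : 0 ≤ p * t ^ (p - 1) := mul_nonneg hp0.le (Real.rpow_nonneg (le_of_lt ht) _)
    rw [ENNReal.ofReal_mul ht', ENNReal.ofReal_sum_of_nonneg fun n _ => sq_nonneg _,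
      Finset.sum_filter, Finset.mul_sum]
    refine Finset.sum_congr rfl fun n _ => ?_
    by_cases h : t < b n <;> simp [h]
  have hlevel : ∀ t ∈ Set.Ioi (0 : ℝ),
      ENNReal.ofReal (p * t ^ (p - 1) * ∑ n ∈ F with t < b n, (ω n * d n) ^ 2)
        ≤ ∫⁻ x, ENNReal.ofReal (k t ‖f x‖) ∂μ := by
    intro t ht
    have ht0 : (0 : ℝ) < t := ht
    have h1 : p * t ^ (p - 1) * ∑ n ∈ F with t < b n, (ω n * d n) ^ 2
        ≤ ∫ x, k t ‖f x‖ ∂μ := by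
      refine (mul_le_mul_of_nonneg_left (h.sum_level_le hω hM hfm hi (τ := K * M * t) ht0)
        (by positivity)).trans (le_of_eq ?_)
      rw [← integral_const_mul]
      refine integral_congr_ae (Eventually.of_forall fun x => ?_)
      have e1 : t ^ (p - 1) = t ^ (p - 2) * t := by
        rw [← Real.rpow_add_one ht0.ne']; congr 1; ring
      have e2 : t ^ (p - 2) = t ^ (p - 3) * t := by
        rw [← Real.rpow_add_one ht0.ne']; congr 1; ring
      simp only [hk, truncKernel]
      split_ifs
      · rw [e1]; field_simp
      · rw [e1, e2]; field_simp
    have hk0 : ∀ x, 0 ≤ k t ‖f x‖ := by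
      intro x
      simp only [hk, truncKernel]
      split_ifs <;> positivity
    refine (ENNReal.ofReal_le_ofReal h1).trans ?_
    -- If the kernel is not integrable, the Bochner integral is `0` and nothing is to be shown.
    by_cases hik : Integrable (fun x => k t ‖f x‖) μ
    · exact (ofReal_integral_eq_lintegral_ofReal hik (Eventually.of_forall hk0)).le
    · simp [integral_undef hik]
  have hmain : ENNReal.ofReal (∑ n ∈ F, b n ^ p * (ω n * d n) ^ 2)
      ≤ ENNReal.ofReal (∫ x, (4 * p * K * M / (p - 1) * (K * M) ^ (1 - p)
        + 4 * p / (2 - p) * (K * M) ^ (2 - p)) * ‖f x‖ ^ p ∂μ) := by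
    rw [hcake, ofReal_integral_eq_lintegral_ofReal (hip.const_mul _)]
    · refine (setLIntegral_mono' measurableSet_Ioi hlevel).trans ?_
      rw [lintegral_lintegral_swap hkm.aemeasurable]
      refine lintegral_mono fun x => le_of_eq ?_
      exact lintegral_truncKernel hp hp2 ha (by positivity) (by positivity) (norm_nonneg _)
    · refine Eventually.of_forall fun x => ?_
      have h1 : 0 < p - 1 := by linarith
      have h2 : 0 < 2 - p := by linarith
      positivity
  rw [integral_const_mul] at hmain
  have hfin := (ENNReal.ofReal_le_ofReal_iff (by
    have h1 : 0 < p - 1 := by linarith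
    have h2 : 0 < 2 - p := by linarith
    have h3 : 0 ≤ ∫ x, ‖f x‖ ^ p ∂μ := integral_nonneg fun x => by positivity
    positivity)).1 hmain
  refine hfin.trans (le_of_eq ?_)
  have e1 : K * M * (K * M) ^ (1 - p) = (K * M) ^ (2 - p) := by
    rw [← Real.rpow_one_add' ha.le (by linarith)]; congr 1; ring
  linear_combination (4 * p / (p - 1) * ∫ x, ‖f x‖ ^ p ∂μ) * e1

/-- The Hausdorff–Young inequality for finite sums. It follows from Paley's inequality for the
weight `ω n = (∑ d m ^ 2)⁻¹`, the sum being over the `m` whose normalized coefficient is at least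
the `n`-th one: with this weight the left side of Paley's inequality is the `p`-th power of a
Lorentz norm that dominates the norm in the conjugate exponent. -/
theorem hausdorff_young (h : IsBesselSystem μ e d K) [IsFiniteMeasure μ] {p p' : ℝ} (hp : 1 < p)
    (hp2 : p < 2) (hpp : p' * (p - 1) = p) (F : Finset ℕ) {f : X → ℂ}
    (hf : MemLp f (ENNReal.ofReal p) μ) :
    ∑ n ∈ F, (‖∫ x, f x * (e n x : ℂ) ∂μ‖ / d n) ^ p' * d n ^ 2
      ≤ ((4 * p / (p - 1) + 4 * p / (2 - p)) * K ^ (2 - p) * ∫ x, ‖f x‖ ^ p ∂μ) ^ (p' / p) := by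
  have hp0 : 0 < p := by linarith
  have hp1 : 0 < p - 1 := by linarith
  have hp'0 : 0 < p' := pos_of_mul_pos_left (hpp.symm ▸ hp0) hp1.le
  set c : ℕ → ℝ := fun n => ‖∫ x, f x * (e n x : ℂ) ∂μ‖ / d n with hc
  have hd := h.pos
  have hc0 : ∀ n, 0 ≤ c n := fun n => div_nonneg (norm_nonneg _) (hd n).le
  set N : ℕ → ℝ := fun n => ∑ m ∈ F with c n ≤ c m, d m ^ 2 with hN
  have hN0 : ∀ n ∈ F, 0 < N n := fun n hn =>
    Finset.sum_pos (fun m _ => pow_pos (hd m) 2) ⟨n, Finset.mem_filter.2 ⟨hn, le_rfl⟩⟩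
  set ω : ℕ → ℝ := fun n => (N n)⁻¹ with hω
  have hω0 : ∀ n ∈ F, 0 < ω n := fun n hn => inv_pos.2 (hN0 n hn)
  have hM : ∀ t > 0, t * ∑ n ∈ F with t ≤ ω n, d n ^ 2 ≤ 1 := by
    intro t ht
    rcases (F.filter fun n => t ≤ ω n).eq_empty_or_nonempty with hS | hS
    · rw [hS]; simp
    -- The sets `{m | c n ≤ c m}` are nested, so the set in question lies in the one for the `n₀`
    -- with the smallest coefficient.
    obtain ⟨n₀, hn₀, hmin⟩ := Finset.exists_min_image _ c hS
    obtain ⟨hn₀F, hn₀⟩ := Finset.mem_filter.1 hn₀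
    have h1 : ∑ n ∈ F with t ≤ ω n, d n ^ 2 ≤ N n₀ :=
      Finset.sum_le_sum_of_subset_of_nonneg
        (fun n hn => Finset.mem_filter.2 ⟨(Finset.mem_filter.1 hn).1, hmin n hn⟩)
        fun n _ _ => sq_nonneg _
    calc _ ≤ ω n₀ * N n₀ := mul_le_mul hn₀ h1 (Finset.sum_nonneg fun n _ => sq_nonneg _)
          (hω0 n₀ hn₀F).le
      _ = 1 := inv_mul_cancel₀ (hN0 n₀ hn₀F).ne'
  have hpal := h.paley hp hp2 one_pos hω0 hM hf
  rw [mul_one] at hpal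
  set B := ∑ n ∈ F, c n ^ p * ω n ^ (2 - p) * d n ^ 2 with hB
  have hBeq : ∑ n ∈ F, (‖∫ x, f x * (e n x : ℂ) ∂μ‖ / (ω n * d n)) ^ p * (ω n * d n) ^ 2 = B := by
    refine Finset.sum_congr rfl fun n hn => ?_
    have e1 : ‖∫ x, f x * (e n x : ℂ) ∂μ‖ / (ω n * d n) = c n / ω n := by
      rw [hc, mul_comm, div_mul_eq_div_div]
    rw [e1, Real.div_rpow (hc0 n) (hω0 n hn).le, Real.rpow_sub (hω0 n hn), Real.rpow_two]
    ring
  rw [hBeq] at hpal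
  have hterm : ∀ n ∈ F, 0 ≤ c n ^ p * ω n ^ (2 - p) * d n ^ 2 := fun n hn => by
    have := hc0 n
    have := hω0 n hn
    positivity
  have hB0 : 0 ≤ B := Finset.sum_nonneg hterm
  -- Monotonicity of `ω` in `c` turns the sum into a pointwise bound, of weak type `p'`.
  have hweak : ∀ n ∈ F, c n ^ p ≤ B * ω n ^ (p - 1) := by
    intro n hn
    have hωn := hω0 n hn
    have h1 : c n ^ p * ω n ^ (2 - p) * N n ≤ B := by
      rw [hN, Finset.mul_sum]
      refine (Finset.sum_le_sum fun m hm => ?_).trans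
        (Finset.sum_le_sum_of_subset_of_nonneg (Finset.filter_subset _ _) fun m hm _ => hterm m hm)
      obtain ⟨hmF, hm⟩ := Finset.mem_filter.1 hm
      have h2 : N m ≤ N n := Finset.sum_le_sum_of_subset_of_nonneg
        (fun k hk => Finset.mem_filter.2 ⟨(Finset.mem_filter.1 hk).1,
          hm.trans (Finset.mem_filter.1 hk).2⟩) fun k _ _ => sq_nonneg _
      have h3 : ω n ≤ ω m := inv_anti₀ (hN0 m hmF) h2
      have h4 : 0 ≤ 2 - p := by linarith
      have := hc0 n
      have := hc0 m
      gcongr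
    have h5 : N n = (ω n)⁻¹ := (inv_inv _).symm
    have h6 : ω n ^ (2 - p) * (ω n)⁻¹ * ω n ^ (p - 1) = 1 := by
      rw [← Real.rpow_neg_one, ← Real.rpow_add hωn, ← Real.rpow_add hωn]
      have : 2 - p + -1 + (p - 1) = 0 := by ring
      rw [this, Real.rpow_zero]
    calc c n ^ p = c n ^ p * ω n ^ (2 - p) * N n * ω n ^ (p - 1) := by
          rw [h5]; linear_combination (-c n ^ p) * h6
      _ ≤ B * ω n ^ (p - 1) := by gcongr
  have hexp : 0 ≤ (p' - p) / p := by
    refine div_nonneg ?_ hp0.le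
    nlinarith
  have hsum : ∑ n ∈ F, c n ^ p' * d n ^ 2 ≤ B ^ (p' / p) := by
    have e0 : p' / p = (p' - p) / p + 1 := by field_simp; ring
    rw [e0, Real.rpow_add_one' hB0 (by positivity), hB, Finset.mul_sum, ← hB]
    refine Finset.sum_le_sum fun n hn => ?_
    have hωn := hω0 n hn
    have e1 : c n ^ p' = c n ^ p * (c n ^ p) ^ ((p' - p) / p) := by
      rw [← Real.rpow_mul (hc0 n), mul_div_cancel₀ _ hp0.ne',
        ← Real.rpow_add_of_nonneg (hc0 n) hp0.le (by nlinarith), add_sub_cancel]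
    have e2 : (ω n ^ (p - 1)) ^ ((p' - p) / p) = ω n ^ (2 - p) := by
      rw [← Real.rpow_mul hωn.le]
      congr 1
      field_simp
      linear_combination hpp
    calc c n ^ p' * d n ^ 2 ≤ c n ^ p * (B * ω n ^ (p - 1)) ^ ((p' - p) / p) * d n ^ 2 := by
          rw [e1]
          have := hc0 n
          have := hweak n hn
          gcongr
      _ = _ := by
          rw [Real.mul_rpow hB0 (by positivity), e2]
          ring
  exact hsum.trans (Real.rpow_le_rpow hB0 hpal (by positivity))

/-- The **Hausdorff–Young–Paley inequality** for finite sums. -/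
theorem hausdorff_young_paley [IsFiniteMeasure μ] (h : IsBesselSystem μ e d K) {p : ℝ} (hp : 1 < p)
    (hp2 : p ≤ 2) : ∃ C : ℝ, 0 ≤ C ∧ ∀ p' s : ℝ, 1 / p + 1 / p' = 1 → p ≤ s → s ≤ p' →
      ∀ (ω : ℕ → ℝ) (M : ℝ), (∀ n, 0 < ω n) → 0 < M →
      (∀ F : Finset ℕ, ∀ t > 0, t * ∑ n ∈ F with t ≤ ω n, d n ^ 2 ≤ M) →
      ∀ f : X → ℂ, MemLp f (ENNReal.ofReal p) μ → ∀ F : Finset ℕ,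
      ∑ n ∈ F, (d n ^ (2 / s - 1) * ω n ^ (1 / s - 1 / p') * ‖∫ x, f x * (e n x : ℂ) ∂μ‖) ^ s
        ≤ (C * M ^ (1 / s - 1 / p') * (∫ x, ‖f x‖ ^ p ∂μ) ^ (1 / p)) ^ s := by
  have hp0 : 0 < p := by linarith
  rcases hp2.eq_or_lt with rfl | hp2
  · refine ⟨1, zero_le_one, fun p' s hpp hs1 hs2 ω M hω hM0 hM f hf F => ?_⟩
    have hp' : p' = 2 := by
      have : 1 / p' = 1 / 2 := by linarith
      simpa using this
    obtain rfl : s = 2 := le_antisymm (hp' ▸ hs2) hs1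
    subst hp'
    have h0 : 0 ≤ ∫ x, ‖f x‖ ^ (2 : ℝ) ∂μ := integral_nonneg fun x => by positivity
    have := h.bessel f (by simpa using hf) F
    simp only [div_self (two_ne_zero (α := ℝ)), sub_self, Real.rpow_zero, one_mul]
    rw [← Real.rpow_mul h0, one_div_mul_cancel two_ne_zero, Real.rpow_one]
    simpa only [Real.rpow_two] using this
  have hp1 : 0 < p - 1 := by linarith
  have hp22 : 0 < 2 - p := by linarith
  set C₁ := (4 * p / (p - 1) + 4 * p / (2 - p)) * K ^ (2 - p) with hC₁
  have hK := h.const_pos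
  have hC0 : 0 ≤ C₁ := by positivity
  refine ⟨C₁ ^ (1 / p), by positivity, fun p' s hpp hs1 hs2 ω M hω hM0 hM f hf F => ?_⟩
  have hp'0 : 0 < p' := by linarith
  have hs0 : 0 < s := by linarith
  have hpp' : p' * (p - 1) = p := by
    field_simp at hpp
    linear_combination (-1) * hpp
  have hpal := h.paley hp hp2 hM0 (fun n _ => hω n) (hM F) hf
  have hhy := h.hausdorff_young hp hp2 hpp' F hf
  set I := ∫ x, ‖f x‖ ^ p ∂μ with hI
  have hI0 : 0 ≤ I := integral_nonneg fun x => by positivity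
  rw [← hC₁] at hhy
  rw [Real.mul_rpow hK.le hM0.le] at hpal
  -- `s = η p + (1 - η) p'`.
  set η := (p' - s) / (p' * (2 - p)) with hη
  have hη0 : 0 ≤ η := div_nonneg (by linarith) (by positivity)
  have hη1 : η ≤ 1 := by
    rw [hη, div_le_one (by positivity)]
    nlinarith
  have hηe : η * (p' * (2 - p)) = p' - s := div_mul_cancel₀ _ (by positivity)
  clear_value η C₁
  have hterm : ∀ n ∈ F, (d n ^ (2 / s - 1) * ω n ^ (1 / s - 1 / p')
        * ‖∫ x, f x * (e n x : ℂ) ∂μ‖) ^ s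
      = ((‖∫ x, f x * (e n x : ℂ) ∂μ‖ / (ω n * d n)) ^ p * (ω n * d n) ^ 2) ^ η
        * ((‖∫ x, f x * (e n x : ℂ) ∂μ‖ / d n) ^ p' * d n ^ 2) ^ (1 - η) := by
    intro n _
    have hd := h.pos n
    have hw := hω n
    have h1η : 0 ≤ 1 - η := by linarith
    set u := ‖∫ x, f x * (e n x : ℂ) ∂μ‖ with hu
    have hu0 : 0 ≤ u := norm_nonneg _
    have eu : (u ^ p) ^ η * (u ^ p') ^ (1 - η) = u ^ s := by
      rw [← Real.rpow_mul hu0, ← Real.rpow_mul hu0,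
        ← Real.rpow_add_of_nonneg hu0 (by positivity) (by positivity)]
      congr 1
      linear_combination (-1) * hηe - η * hpp'
    have hwp : ∀ r : ℝ, 0 < ω n ^ r := fun r => Real.rpow_pos_of_pos hw r
    have hdp : ∀ r : ℝ, 0 < d n ^ r := fun r => Real.rpow_pos_of_pos hd r
    have ew : (ω n ^ (1 / s - 1 / p')) ^ s = (ω n ^ (2 - p)) ^ η := by
      rw [← Real.rpow_mul hw.le, ← Real.rpow_mul hw.le]
      congr 1
      field_simp
      linear_combination (-1) * hηe
    have ed : (d n ^ (2 / s - 1)) ^ s = (d n ^ (2 - p)) ^ η * (d n ^ (2 - p')) ^ (1 - η) := by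
      rw [← Real.rpow_mul hd.le, ← Real.rpow_mul hd.le, ← Real.rpow_mul hd.le,
        ← Real.rpow_add hd]
      congr 1
      field_simp
      linear_combination (-1) * hηe - η * hpp'
    have e1 : (u / (ω n * d n)) ^ p * (ω n * d n) ^ 2
        = u ^ p * (ω n ^ (2 - p) * d n ^ (2 - p)) := by
      rw [Real.div_rpow hu0 (by positivity), Real.mul_rpow hw.le hd.le, Real.rpow_sub hw,
        Real.rpow_sub hd, Real.rpow_two, Real.rpow_two]
      ring
    have e2 : (u / d n) ^ p' * d n ^ 2 = u ^ p' * d n ^ (2 - p') := by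
      rw [Real.div_rpow hu0 hd.le, Real.rpow_sub hd, Real.rpow_two]
      ring
    rw [e1, e2, Real.mul_rpow (by positivity) hu0, Real.mul_rpow (hdp _).le (hwp _).le, ew, ed,
      ← eu, Real.mul_rpow (by positivity) (by positivity), Real.mul_rpow (hwp _).le (hdp _).le,
      Real.mul_rpow (by positivity) (hdp _).le]
    ring
  rw [Finset.sum_congr rfl hterm]
  have hd := h.pos
  refine (sum_rpow_mul_rpow_le F
    (fun n _ => mul_nonneg (Real.rpow_nonneg (div_nonneg (norm_nonneg _)
      (mul_pos (hω n) (hd n)).le) _) (sq_nonneg _))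
    (fun n _ => mul_nonneg (Real.rpow_nonneg (div_nonneg (norm_nonneg _) (hd n).le) _)
      (sq_nonneg _)) hη0 hη1).trans ?_
  have hD0 : 0 ≤ C₁ * I := by positivity
  calc _ ≤ (M ^ (2 - p) * (C₁ * I)) ^ η * ((C₁ * I) ^ (p' / p)) ^ (1 - η) := by
        refine mul_le_mul (Real.rpow_le_rpow ?_ ?_ hη0) (Real.rpow_le_rpow ?_ hhy (by linarith))
          (Real.rpow_nonneg ?_ _) (by positivity)
        · exact Finset.sum_nonneg fun n _ => mul_nonneg (Real.rpow_nonneg (div_nonneg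
            (norm_nonneg _) (mul_pos (hω n) (hd n)).le) _) (sq_nonneg _)
        · exact hpal.trans (le_of_eq (by rw [hC₁]; ring))
        all_goals exact Finset.sum_nonneg fun n _ => mul_nonneg (Real.rpow_nonneg (div_nonneg
            (norm_nonneg _) (hd n).le) _) (sq_nonneg _)
    _ = (C₁ ^ (1 / p) * M ^ (1 / s - 1 / p') * I ^ (1 / p)) ^ s := by
        have h1η : 0 ≤ 1 - η := by linarith
        rw [mul_right_comm, ← Real.mul_rpow hC0 hI0, Real.mul_rpow (by positivity) (by positivity),
          Real.mul_rpow (x := (C₁ * I) ^ (1 / p)) (by positivity) (by positivity),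
          ← Real.rpow_mul hD0, ← Real.rpow_mul hD0,
          ← Real.rpow_mul hM0.le, ← Real.rpow_mul hM0.le, mul_assoc,
          ← Real.rpow_add_of_nonneg hD0 hη0 (by positivity), mul_comm]
        congr 2
        · field_simp
          linear_combination (-1) * hηe - η * hpp'
        · field_simp
          linear_combination hηe

/-! ### Synthesis by duality -/

theorem memLp_ofReal (h : IsBesselSystem μ e d K) [IsFiniteMeasure μ] (n : ℕ) (q : ℝ≥0∞) :
    MemLp (fun x => (e n x : ℂ)) q μ := by
  refine MemLp.of_bound (Complex.continuous_ofReal.comp_aestronglyMeasurable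
    (h.aestronglyMeasurable n)) (K * d n) ?_
  filter_upwards [h.bound n] with x hx
  simpa using hx

/-- The dual of an estimate for coefficients: `V` is the constant of the estimate on `L^{q'}`, with
weights `v⁻¹`. The estimate is tested on the function `|Φ| ^ (q - 2) Φ`. -/
theorem integral_sum_rpow_le (h : IsBesselSystem μ e d K) [IsFiniteMeasure μ] {q q' r r' V : ℝ}
    (hq : 2 ≤ q) (hqq : 1 / q + 1 / q' = 1) (hr : 1 < r) (hrr : 1 / r + 1 / r' = 1) {v : ℕ → ℝ}
    (hv : ∀ n, 0 < v n) (hV : 0 ≤ V) (F : Finset ℕ)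
    (hest : ∀ g : X → ℂ, MemLp g (ENNReal.ofReal q') μ →
      ∑ n ∈ F, ((v n)⁻¹ * ‖∫ x, g x * (e n x : ℂ) ∂μ‖) ^ r
        ≤ (V * (∫ x, ‖g x‖ ^ q' ∂μ) ^ (1 / q')) ^ r) (φ : ℕ → ℝ) :
    (∫ x, |∑ n ∈ F, φ n * e n x| ^ q ∂μ) ^ (1 / q)
      ≤ V * (∑ n ∈ F, (v n * |φ n|) ^ r') ^ (1 / r') := by
  have hq0 : 0 < q := by linarith
  have hq'0 : 0 < q' := by
    have h1 : 1 / q < 1 := by rw [div_lt_one hq0]; linarith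
    exact one_div_pos.1 (by linarith)
  have hqe : (q - 1) * q' = q := by field_simp at hqq; linear_combination (-1) * hqq
  have hrc : r.HolderConjugate r' := Real.holderConjugate_iff.2 ⟨hr, by simpa using hrr⟩
  have hr0 : 0 < r := hrc.pos
  set Φ : X → ℝ := fun x => ∑ n ∈ F, φ n * e n x with hΦ
  set g : X → ℝ := fun x => |Φ x| ^ (q - 2) * Φ x with hg
  set J := ∫ x, |Φ x| ^ q ∂μ with hJ
  have hJ0 : 0 ≤ J := integral_nonneg fun x => by positivity
  have hS0 : 0 ≤ ∑ n ∈ F, (v n * |φ n|) ^ r' :=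
    Finset.sum_nonneg fun n _ => Real.rpow_nonneg (mul_nonneg (hv n).le (abs_nonneg _)) _
  rcases hJ0.eq_or_lt with hJz | hJpos
  · rw [← hJz, Real.zero_rpow (by positivity)]
    positivity
  have hΦm : AEStronglyMeasurable Φ μ :=
    Finset.aestronglyMeasurable_fun_sum F fun n _ => (h.aestronglyMeasurable n).const_mul _
  have hΦb : ∀ᵐ x ∂μ, |Φ x| ≤ ∑ n ∈ F, |φ n| * (K * d n) := by
    filter_upwards [ae_all_iff.2 h.bound] with x hx
    refine (Finset.abs_sum_le_sum_abs _ _).trans (Finset.sum_le_sum fun n _ => ?_)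
    rw [abs_mul]
    gcongr
    exact hx n
  set B := ∑ n ∈ F, |φ n| * (K * d n) with hB
  have hgm : AEStronglyMeasurable g μ := by
    have hc : Continuous fun y : ℝ => |y| ^ (q - 2) * y :=
      (continuous_abs.rpow_const fun _ => Or.inr (by linarith)).mul continuous_id
    exact hc.comp_aestronglyMeasurable hΦm
  have hgabs : ∀ x, |g x| = |Φ x| ^ (q - 1) := by
    intro x
    have : q - 1 = q - 2 + 1 := by ring
    rw [hg, this, Real.rpow_add_one' (abs_nonneg _) (by linarith), abs_mul,
      abs_of_nonneg (Real.rpow_nonneg (abs_nonneg _) _)]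
  have hgb : ∀ᵐ x ∂μ, |g x| ≤ B ^ (q - 1) := by
    filter_upwards [hΦb] with x hx
    rw [hgabs]
    exact Real.rpow_le_rpow (abs_nonneg _) hx (by linarith)
  have hgL : MemLp (fun x => (g x : ℂ)) (ENNReal.ofReal q') μ := by
    refine MemLp.of_bound (Complex.continuous_ofReal.comp_aestronglyMeasurable hgm) (B ^ (q - 1)) ?_
    filter_upwards [hgb] with x hx
    simpa using hx
  have hgJ : ∫ x, ‖(g x : ℂ)‖ ^ q' ∂μ = J := by
    refine integral_congr_ae (Eventually.of_forall fun x => ?_)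
    simp only [Complex.norm_real, Real.norm_eq_abs]
    rw [hgabs, ← Real.rpow_mul (abs_nonneg _), hqe]
  have hgi : Integrable (fun x => (g x : ℂ)) μ :=
    Integrable.of_bound (Complex.continuous_ofReal.comp_aestronglyMeasurable hgm) (B ^ (q - 1)) (by
      filter_upwards [hgb] with x hx
      simpa using hx)
  -- `g` realizes duality: `∫ g Φ = ∫ |Φ| ^ q = J`, while `‖g‖_{q'} = J ^ (1 / q')`.
  have hpair : (J : ℂ) = ∑ n ∈ F, (φ n : ℂ) * ∫ x, (g x : ℂ) * (e n x : ℂ) ∂μ := by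
    simp only [← integral_const_mul]
    rw [← integral_finsetSum _ fun n _ => (h.integrable_mul hgi n).const_mul _, hJ,
      ← integral_complex_ofReal]
    refine integral_congr_ae (Eventually.of_forall fun x => ?_)
    have e1 : |Φ x| ^ q = g x * Φ x := by
      have : q = q - 2 + 2 := by ring
      rw [hg, this, Real.rpow_add_of_nonneg (abs_nonneg _) (by linarith) (by norm_num),
        Real.rpow_two, sq_abs]
      ring_nf
    simp only [e1]
    rw [hΦ]
    push_cast
    rw [Finset.mul_sum]
    exact Finset.sum_congr rfl fun n _ => by ring
  have hJle : J ≤ V * (∑ n ∈ F, (v n * |φ n|) ^ r') ^ (1 / r') * J ^ (1 / q') := by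
    calc J = ‖(J : ℂ)‖ := by rw [Complex.norm_real, Real.norm_of_nonneg hJ0]
      _ ≤ ∑ n ∈ F, (v n * |φ n|) * ((v n)⁻¹ * ‖∫ x, (g x : ℂ) * (e n x : ℂ) ∂μ‖) := by
          rw [hpair]
          refine (norm_sum_le _ _).trans (Finset.sum_le_sum fun n _ => le_of_eq ?_)
          rw [norm_mul, Complex.norm_real, Real.norm_eq_abs]
          field_simp [(hv n).ne']
      _ ≤ (∑ n ∈ F, (v n * |φ n|) ^ r') ^ (1 / r')
          * (∑ n ∈ F, ((v n)⁻¹ * ‖∫ x, (g x : ℂ) * (e n x : ℂ) ∂μ‖) ^ r) ^ (1 / r) :=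
          Real.inner_le_Lp_mul_Lq_of_nonneg F hrc.symm
            (fun n _ => mul_nonneg (hv n).le (abs_nonneg _))
            fun n _ => mul_nonneg (inv_nonneg.2 (hv n).le) (norm_nonneg _)
      _ ≤ (∑ n ∈ F, (v n * |φ n|) ^ r') ^ (1 / r') * (V * J ^ (1 / q')) := by
          gcongr
          have h1 := hest _ hgL
          rw [hgJ] at h1
          have h2 := Real.rpow_le_rpow (Finset.sum_nonneg fun n _ => Real.rpow_nonneg
            (mul_nonneg (inv_nonneg.2 (hv n).le) (norm_nonneg _)) _) h1
            (one_div_nonneg.2 hr0.le)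
          rwa [← Real.rpow_mul (by positivity), mul_one_div_cancel hr0.ne', Real.rpow_one] at h2
      _ = _ := by ring
  have hJq : J = J ^ (1 / q) * J ^ (1 / q') := by
    rw [← Real.rpow_add hJpos, hqq, Real.rpow_one]
  have hpos : 0 < J ^ (1 / q') := Real.rpow_pos_of_pos hJpos _
  refine le_of_mul_le_mul_right ?_ hpos
  rw [← hJq]
  exact hJle

/-- Synthesis: a coefficient estimate on `L^{q'}` and orthonormality give the convergence in `L^q`
of every series whose coefficients lie in the dual sequence space. -/
theorem exists_memLp_of_summable (h : IsBesselSystem μ e d K) [IsFiniteMeasure μ]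
    (horth : ∀ m n, ∫ x, e m x * e n x ∂μ = if m = n then 1 else 0) {q q' r r' V : ℝ}
    (hq : 2 ≤ q) (hqq : 1 / q + 1 / q' = 1) (hr : 1 < r) (hrr : 1 / r + 1 / r' = 1) {v : ℕ → ℝ}
    (hv : ∀ n, 0 < v n) (hV : 0 ≤ V)
    (hest : ∀ g : X → ℂ, MemLp g (ENNReal.ofReal q') μ → ∀ F : Finset ℕ,
      ∑ n ∈ F, ((v n)⁻¹ * ‖∫ x, g x * (e n x : ℂ) ∂μ‖) ^ r
        ≤ (V * (∫ x, ‖g x‖ ^ q' ∂μ) ^ (1 / q')) ^ r) {φ : ℕ → ℝ}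
    (hφ : Summable fun n => (v n * |φ n|) ^ r') :
    ∃ f : X → ℂ, MemLp f (ENNReal.ofReal q) μ ∧
      Tendsto (fun N : ℕ => eLpNorm
        (fun x => (∑ n ∈ Finset.range (N + 1), (φ n : ℂ) * (e n x : ℂ)) - f x)
        (ENNReal.ofReal q) μ) atTop (𝓝 0) ∧
      (∀ n, ∫ x, f x * (e n x : ℂ) ∂μ = (φ n : ℂ)) ∧
      eLpNorm f (ENNReal.ofReal q) μ
        ≤ ENNReal.ofReal (V * (∑' n, (v n * |φ n|) ^ r') ^ (1 / r')) := by
  have hq0 : 0 < q := by linarith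
  have hrc : r.HolderConjugate r' := Real.holderConjugate_iff.2 ⟨hr, by simpa using hrr⟩
  have hr'0 : 0 < r' := hrc.symm.pos
  have : Fact (1 ≤ ENNReal.ofReal q) := ⟨by simpa using (by linarith : (1 : ℝ) ≤ q)⟩
  have hterm : ∀ n, 0 ≤ (v n * |φ n|) ^ r' := fun n =>
    Real.rpow_nonneg (mul_nonneg (hv n).le (abs_nonneg _)) _
  have hmem : ∀ n, MemLp (fun x => (φ n : ℂ) * (e n x : ℂ)) (ENNReal.ofReal q) μ := fun n =>
    (h.memLp_ofReal n _).const_mul _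
  set y : ℕ → Lp ℂ (ENNReal.ofReal q) μ := fun n => (hmem n).toLp _ with hy
  have hmemS : ∀ F : Finset ℕ, MemLp (fun x => ∑ n ∈ F, (φ n : ℂ) * (e n x : ℂ))
      (ENNReal.ofReal q) μ := fun F => memLp_finsetSum F fun n _ => hmem n
  have hySum : ∀ F : Finset ℕ, ∑ n ∈ F, y n = (hmemS F).toLp _ := by
    intro F
    refine Lp.ext ?_
    refine (Lp.coeFn_finsetSum F y).trans ?_
    filter_upwards [ae_all_iff.2 fun n => (hmem n).coeFn_toLp, (hmemS F).coeFn_toLp] with x h1 h2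
    rw [h2, Finset.sum_apply]
    exact Finset.sum_congr rfl fun n _ => h1 n
  -- The synthesis bound holds for every block, hence the series is summable in `L^q`.
  have hnorm : ∀ F : Finset ℕ,
      ‖∑ n ∈ F, y n‖ ≤ V * (∑ n ∈ F, (v n * |φ n|) ^ r') ^ (1 / r') := by
    intro F
    refine le_trans (le_of_eq ?_)
      (h.integral_sum_rpow_le hq hqq hr hrr hv hV F (fun g hg => hest g hg F) φ)
    rw [hySum, Lp.norm_toLp, (hmemS F).eLpNorm_eq_integral_rpow_norm (by simpa using hq0)
      ENNReal.ofReal_ne_top, ENNReal.toReal_ofReal (by positivity), ENNReal.toReal_ofReal hq0.le,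
      one_div]
    congr 2
    funext x
    have : ∑ n ∈ F, (φ n : ℂ) * (e n x : ℂ) = ((∑ n ∈ F, φ n * e n x : ℝ) : ℂ) := by push_cast; rfl
    rw [this, Complex.norm_real, Real.norm_eq_abs]
  have hsummable : Summable y := by
    rw [summable_iff_vanishing_norm]
    intro ε hε
    have hlim : Tendsto (fun S : ℝ => V * S ^ (1 / r')) (𝓝 0) (𝓝 0) := by
      have := (Real.continuousAt_rpow_const (0 : ℝ) (1 / r') (Or.inr (by positivity))).tendsto.const_mul V
      simpa [Real.zero_rpow (show r'⁻¹ ≠ 0 by positivity)] using this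
    obtain ⟨δ, hδ, hδε⟩ := Metric.tendsto_nhds_nhds.1 hlim ε hε
    obtain ⟨s, hs⟩ := summable_iff_vanishing_norm.1 hφ δ hδ
    refine ⟨s, fun t ht => (hnorm t).trans_lt ?_⟩
    have h1 := hδε (x := ∑ n ∈ t, (v n * |φ n|) ^ r') (by simpa using hs t ht)
    rw [dist_zero_right] at h1
    exact (le_abs_self _).trans_lt h1
  set z := ∑' n, y n with hz
  have hzsum : HasSum y z := hsummable.hasSum
  have hznorm : ‖z‖ ≤ V * (∑' n, (v n * |φ n|) ^ r') ^ (1 / r') := by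
    refine le_of_tendsto hzsum.norm (Eventually.of_forall fun F => (hnorm F).trans ?_)
    gcongr
    · exact Finset.sum_nonneg fun n _ => hterm n
    · exact hφ.sum_le_tsum F fun n _ => hterm n
  have htend : Tendsto (fun N : ℕ => eLpNorm
      (fun x => (∑ n ∈ Finset.range (N + 1), (φ n : ℂ) * (e n x : ℂ)) - z x)
      (ENNReal.ofReal q) μ) atTop (𝓝 0) := by
    have h1 : Tendsto (fun N : ℕ => ∑ n ∈ Finset.range (N + 1), y n) atTop (𝓝 z) :=
      hzsum.tendsto_sum_nat.comp (tendsto_add_atTop_nat 1)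
    rw [tendsto_iff_edist_tendsto_0] at h1
    refine h1.congr fun N => ?_
    rw [hySum, Lp.edist_def]
    refine eLpNorm_congr_ae ?_
    filter_upwards [(hmemS (Finset.range (N + 1))).coeFn_toLp] with x hx
    simp [hx]
  refine ⟨z, Lp.memLp z, htend, fun n => ?_, ?_⟩
  -- Coefficients are continuous on `L^q`, and those of the partial sums are eventually constant.
  · have hzi : Integrable z μ := (Lp.memLp z).integrable this.out
    set w : ℕ → X → ℂ := fun N x =>
      (∑ m ∈ Finset.range (N + 1), (φ m : ℂ) * (e m x : ℂ)) - z x with hw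
    have hwL : ∀ N, MemLp (w N) (ENNReal.ofReal q) μ := fun N => (hmemS _).sub (Lp.memLp z)
    have hwi : ∀ N, Integrable (w N) μ := fun N => (hwL N).integrable this.out
    have hw1 : Tendsto (fun N => ∫ x, ‖w N x‖ ∂μ) atTop (𝓝 0) := by
      have h1 : Tendsto (fun N => eLpNorm (w N) (ENNReal.ofReal q) μ
          * μ Set.univ ^ (1 / (1 : ℝ≥0∞).toReal - 1 / (ENNReal.ofReal q).toReal)) atTop (𝓝 0) := by
        have hfin : μ Set.univ ^ (1 / (1 : ℝ≥0∞).toReal - 1 / (ENNReal.ofReal q).toReal) ≠ ∞ := by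
          refine ENNReal.rpow_ne_top_of_nonneg ?_ (measure_ne_top _ _)
          rw [ENNReal.toReal_ofReal hq0.le, ENNReal.toReal_one, sub_nonneg]
          exact one_div_le_one_div_of_le one_pos (by linarith)
        simpa using ENNReal.Tendsto.mul_const htend (Or.inr hfin)
      have h2 : Tendsto (fun N => eLpNorm (w N) 1 μ) atTop (𝓝 0) :=
        tendsto_of_tendsto_of_tendsto_of_le_of_le tendsto_const_nhds h1 (fun _ => zero_le)
          fun N => eLpNorm_le_eLpNorm_mul_rpow_measure_univ this.out (hwL N).1
      have h3 := (ENNReal.tendsto_toReal ENNReal.zero_ne_top).comp h2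
      refine h3.congr fun N => ?_
      rw [Function.comp_apply, eLpNorm_one_eq_lintegral_enorm,
        integral_norm_eq_lintegral_enorm (hwi N).1]
    have hw2 : Tendsto (fun N => ∫ x, w N x * (e n x : ℂ) ∂μ) atTop (𝓝 0) := by
      refine squeeze_zero_norm (fun N => h.norm_integral_mul_le (hwi N) n) ?_
      simpa using hw1.const_mul (K * d n)
    have hcoef : ∀ N ≥ n, ∫ x, w N x * (e n x : ℂ) ∂μ = φ n - ∫ x, z x * (e n x : ℂ) ∂μ := by
      intro N hN
      have hsi := (hmemS (Finset.range (N + 1))).integrable this.out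
      simp only [hw, sub_mul]
      rw [integral_sub (h.integrable_mul hsi n) (h.integrable_mul hzi n)]
      congr 1
      simp only [Finset.sum_mul, mul_assoc]
      rw [integral_finsetSum _ fun m _ => (h.integrable_mul
        ((h.memLp_ofReal m 1).integrable le_rfl) n).const_mul _]
      simp only [integral_const_mul, ← Complex.ofReal_mul, integral_complex_ofReal, horth]
      simp only [mul_ite, mul_one, mul_zero]
      rw [← Complex.ofReal_sum, Finset.sum_ite_eq', if_pos (Finset.mem_range.2 (by omega))]
    have hconst : Tendsto (fun N => ∫ x, w N x * (e n x : ℂ) ∂μ) atTop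
        (𝓝 (φ n - ∫ x, z x * (e n x : ℂ) ∂μ)) :=
      tendsto_const_nhds.congr' (by
        filter_upwards [eventually_ge_atTop n] with N hN
        exact (hcoef N hN).symm)
    exact (sub_eq_zero.1 (tendsto_nhds_unique hconst hw2)).symm
  · rw [← Lp.enorm_def, ← ofReal_norm]
    exact ENNReal.ofReal_le_ofReal hznorm

end IsBesselSystem

/-! ### The Jacobi system -/

/-- Bessel's inequality for real orthonormal functions and complex-valued `g`. -/
theorem sum_norm_integral_sq_le {X : Type*} [MeasurableSpace X] {μ : Measure X} {e : ℕ → X → ℝ}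
    (he : ∀ n, MemLp (fun x => (e n x : ℂ)) 2 μ)
    (horth : ∀ m n, ∫ x, e m x * e n x ∂μ = if m = n then 1 else 0) {g : X → ℂ} (hg : MemLp g 2 μ)
    (F : Finset ℕ) : ∑ n ∈ F, ‖∫ x, g x * (e n x : ℂ) ∂μ‖ ^ 2 ≤ ∫ x, ‖g x‖ ^ 2 ∂μ := by
  have hinner : ∀ (n : ℕ) (u : X → ℂ) (hu : MemLp u 2 μ),
      inner ℂ ((he n).toLp _) (hu.toLp u) = ∫ x, u x * (e n x : ℂ) ∂μ := by
    intro n u hu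
    rw [L2.inner_def]
    refine integral_congr_ae ?_
    filter_upwards [(he n).coeFn_toLp, hu.coeFn_toLp] with x h1 h2
    rw [h1, h2, RCLike.inner_apply, Complex.conj_ofReal]
  have hon : Orthonormal ℂ fun n => (he n).toLp (fun x => (e n x : ℂ)) := by
    rw [orthonormal_iff_ite]
    intro m n
    rw [hinner]
    simp only [← Complex.ofReal_mul]
    rw [integral_complex_ofReal, horth]
    by_cases h : m = n
    · simp [h]
    · simp [h, Ne.symm h]
  have hb := hon.sum_inner_products_le (s := F) (hg.toLp g)
  simp only [hinner] at hb
  refine hb.trans (le_of_eq ?_)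
  have h1 : ((‖hg.toLp g‖ ^ 2 : ℝ) : ℂ) = ((∫ x, ‖g x‖ ^ 2 ∂μ : ℝ) : ℂ) := by
    have h2 : inner ℂ (hg.toLp g) (hg.toLp g) = ((‖hg.toLp g‖ ^ 2 : ℝ) : ℂ) := by
      rw [inner_self_eq_norm_sq_to_K]; simp
    rw [← h2, L2.inner_def, ← integral_complex_ofReal]
    refine integral_congr_ae ?_
    filter_upwards [hg.coeFn_toLp] with x hx
    rw [hx, inner_self_eq_norm_sq_to_K]
    simp
  exact_mod_cast h1

theorem exists_isBesselSystem_jacobiON {α β : ℝ} (hα : -1 < α) (hβ : -1 < β) :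
    ∃ K, IsBesselSystem (jacobiMeasure α β) (jacobiON α β)
      (fun n => ((n : ℝ) + 1) ^ jacobiSigma α β) K := by
  have := isFiniteMeasure_jacobiMeasure hα hβ
  obtain ⟨K, hK, hb⟩ := exists_abs_jacobiON_le hα hβ
  have hbound : ∀ n, ∀ᵐ x ∂jacobiMeasure α β,
      |jacobiON α β n x| ≤ K * ((n : ℝ) + 1) ^ jacobiSigma α β := fun n => by
    filter_upwards [ae_mem_Ioo_jacobiMeasure α β] with x hx
    exact hb n x (Set.Ioo_subset_Icc_self hx)
  refine ⟨K, ⟨fun n => (continuous_jacobiON α β n).aestronglyMeasurable,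
    fun n => by positivity, hK, hbound, fun g hg F => ?_⟩⟩
  refine sum_norm_integral_sq_le (fun n => ?_) (integral_jacobiON_mul_jacobiON hα hβ) hg F
  refine MemLp.of_bound (Complex.continuous_ofReal.comp
    (continuous_jacobiON α β n)).aestronglyMeasurable (K * ((n : ℝ) + 1) ^ jacobiSigma α β) ?_
  filter_upwards [hbound n] with x hx
  simpa using hx

/-- The supremum defining `paleyM`, read for finite sums of real numbers. -/
theorem mul_sum_le_toReal_paleyM {α β : ℝ} {ω : ℕ → ℝ} (hM : paleyM α β ω < ∞) (F : Finset ℕ)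
    {t : ℝ} (ht : 0 < t) :
    t * ∑ n ∈ F with t ≤ ω n, (((n : ℝ) + 1) ^ jacobiSigma α β) ^ 2 ≤ (paleyM α β ω).toReal := by
  rw [← ENNReal.ofReal_le_iff_le_toReal hM.ne, ENNReal.ofReal_mul ht.le,
    ENNReal.ofReal_sum_of_nonneg fun n _ => sq_nonneg _]
  refine le_trans ?_ (le_iSup₂ (f := fun (t : ℝ) (_ : 0 < t) => ENNReal.ofReal t *
    ∑' n : {n : ℕ // t ≤ ω n}, ENNReal.ofReal (((n : ℕ) + 1 : ℝ) ^ (2 * jacobiSigma α β))) t ht)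
  gcongr
  have h1 := tsum_subtype {n : ℕ | t ≤ ω n}
    fun n : ℕ => ENNReal.ofReal (((n : ℕ) + 1 : ℝ) ^ (2 * jacobiSigma α β))
  refine le_trans ?_ h1.symm.le
  rw [Finset.sum_filter]
  refine le_trans (Finset.sum_le_sum fun n _ => le_of_eq ?_) (ENNReal.sum_le_tsum F)
  by_cases h : t ≤ ω n
  · have hn : (0 : ℝ) ≤ (n : ℝ) + 1 := by positivity
    simp only [h, if_true, Set.indicator, Set.mem_ofPred_eq]
    rw [mul_comm (2 : ℝ), Real.rpow_mul hn, Real.rpow_two]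
  · simp [h]

theorem toReal_paleyM_pos {α β : ℝ} {ω : ℕ → ℝ} (hω : ∀ n, 0 < ω n) (hM : paleyM α β ω < ∞) :
    0 < (paleyM α β ω).toReal := by
  refine lt_of_lt_of_le ?_ (mul_sum_le_toReal_paleyM hM {0} (hω 0))
  have : (Finset.filter (fun n => ω 0 ≤ ω n) {0}) = {0} := by simp
  rw [this]
  simpa using hω 0

/-- The coefficient estimate for the Jacobi system, for finite sums of real numbers. The constant
depends only on `p`, `α` and `β`. -/
theorem exists_sum_jacobiCoeff_le {α β : ℝ} (hα : -1 < α) (hβ : -1 < β) {p : ℝ} (hp : 1 < p)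
    (hp2 : p ≤ 2) : ∃ C : ℝ, 0 ≤ C ∧ ∀ p' s : ℝ, 1 / p + 1 / p' = 1 → p ≤ s → s ≤ p' →
      ∀ ω : ℕ → ℝ, (∀ n, 0 < ω n) → paleyM α β ω < ∞ →
      ∀ f : ℝ → ℂ, MemLp f (ENNReal.ofReal p) (jacobiMeasure α β) → ∀ F : Finset ℕ,
      ∑ n ∈ F, (((n : ℝ) + 1) ^ ((2 / s - 1) * jacobiSigma α β) * ω n ^ (1 / s - 1 / p')
          * ‖jacobiCoeff α β f n‖) ^ s
        ≤ (C * (paleyM α β ω).toReal ^ (1 / s - 1 / p')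
          * (∫ x, ‖f x‖ ^ p ∂jacobiMeasure α β) ^ (1 / p)) ^ s := by
  have := isFiniteMeasure_jacobiMeasure hα hβ
  obtain ⟨K, hB⟩ := exists_isBesselSystem_jacobiON hα hβ
  obtain ⟨C, hC0, hC⟩ := hB.hausdorff_young_paley hp hp2
  refine ⟨C, hC0, fun p' s hpp hs1 hs2 ω hω hM f hf F => ?_⟩
  refine le_trans (le_of_eq (Finset.sum_congr rfl fun n _ => ?_))
    (hC p' s hpp hs1 hs2 ω _ hω (toReal_paleyM_pos hω hM)
      (fun F t ht => mul_sum_le_toReal_paleyM hM F ht) f hf F)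
  rw [mul_comm (2 / s - 1), Real.rpow_mul (by positivity : (0 : ℝ) ≤ (n : ℝ) + 1)]
  rfl

theorem theorem3 (α β : ℝ) (hα : -1 < α) (hβ : -1 < β) :
    ∃ C : ℝ → ℝ → ℝ≥0,
      (∀ p p' s : ℝ, 1 < p → p ≤ 2 → 1 / p + 1 / p' = 1 → p ≤ s → s ≤ p' →
        ∀ ω : ℕ → ℝ, (∀ n, 0 < ω n) → paleyM α β ω < ∞ →
        ∀ f : ℝ → ℂ, MemLp f (ENNReal.ofReal p) (jacobiMeasure α β) →
          (∑' n : ℕ, ENNReal.ofReal (((n : ℝ) + 1) ^ ((2 / s - 1) * jacobiSigma α β)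
              * ω n ^ (1 / s - 1 / p') * ‖jacobiCoeff α β f n‖) ^ s) ^ (1 / s)
            ≤ (C p s : ℝ≥0∞) * paleyM α β ω ^ (1 / s - 1 / p')
              * eLpNorm f (ENNReal.ofReal p) (jacobiMeasure α β)) ∧
      (∀ q q' r r' : ℝ, 2 ≤ q → 1 / q + 1 / q' = 1 → q' ≤ r → r ≤ q → 1 / r + 1 / r' = 1 →
        ∀ ω : ℕ → ℝ, (∀ n, 0 < ω n) → paleyM α β ω < ∞ →
        ∀ φ : ℕ → ℝ, (∀ n, 0 ≤ φ n) →
          ∑' n : ℕ, ENNReal.ofReal (((n : ℝ) + 1) ^ ((1 - 2 / r) * jacobiSigma α β)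
              * ω n ^ (1 / q - 1 / r) * |φ n|) ^ r' < ∞ →
          ∃ f : ℝ → ℂ, MemLp f (ENNReal.ofReal q) (jacobiMeasure α β) ∧
            Tendsto (fun N : ℕ => eLpNorm
                (fun t => (∑ n ∈ Finset.range (N + 1), (φ n : ℂ) * (jacobiON α β n t : ℂ)) - f t)
                (ENNReal.ofReal q) (jacobiMeasure α β)) atTop (𝓝 0) ∧
            (∀ n, jacobiCoeff α β f n = (φ n : ℂ)) ∧
            eLpNorm f (ENNReal.ofReal q) (jacobiMeasure α β)
              ≤ (C q' r : ℝ≥0∞) * paleyM α β ω ^ (1 / r - 1 / q)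
                * (∑' n : ℕ, ENNReal.ofReal (((n : ℝ) + 1) ^ ((1 - 2 / r) * jacobiSigma α β)
                    * ω n ^ (1 / q - 1 / r) * |φ n|) ^ r') ^ (1 / r')) := by
  have := isFiniteMeasure_jacobiMeasure hα hβ
  have hex : ∀ p : ℝ, ∃ C : ℝ≥0, 1 < p → p ≤ 2 → ∀ p' s : ℝ, 1 / p + 1 / p' = 1 → p ≤ s →
      s ≤ p' → ∀ ω : ℕ → ℝ, (∀ n, 0 < ω n) → paleyM α β ω < ∞ →
      ∀ f : ℝ → ℂ, MemLp f (ENNReal.ofReal p) (jacobiMeasure α β) → ∀ F : Finset ℕ,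
      ∑ n ∈ F, (((n : ℝ) + 1) ^ ((2 / s - 1) * jacobiSigma α β) * ω n ^ (1 / s - 1 / p')
          * ‖jacobiCoeff α β f n‖) ^ s
        ≤ ((C : ℝ) * (paleyM α β ω).toReal ^ (1 / s - 1 / p')
          * (∫ x, ‖f x‖ ^ p ∂jacobiMeasure α β) ^ (1 / p)) ^ s := by
    intro p
    by_cases hp : 1 < p ∧ p ≤ 2
    · obtain ⟨C, hC0, hC⟩ := exists_sum_jacobiCoeff_le hα hβ hp.1 hp.2
      exact ⟨⟨C, hC0⟩, fun _ _ => hC⟩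
    · exact ⟨0, fun h1 h2 => absurd ⟨h1, h2⟩ hp⟩
  choose C hC using hex
  refine ⟨fun p _ => C p, ?_, ?_⟩
  · intro p p' s hp hp2 hpp hs1 hs2 ω hω hM f hf
    have hp0 : 0 < p := by linarith
    have hs0 : 0 < s := by linarith
    have hexp : 0 ≤ 1 / s - 1 / p' := sub_nonneg.2 (one_div_le_one_div_of_le hs0 hs2)
    have hM0 := toReal_paleyM_pos hω hM
    have hI0 : 0 ≤ ∫ x, ‖f x‖ ^ p ∂jacobiMeasure α β := integral_nonneg fun x => by positivity
    have hrhs : (C p : ℝ≥0∞) * paleyM α β ω ^ (1 / s - 1 / p')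
        * eLpNorm f (ENNReal.ofReal p) (jacobiMeasure α β)
        = ENNReal.ofReal ((C p : ℝ) * (paleyM α β ω).toReal ^ (1 / s - 1 / p')
          * (∫ x, ‖f x‖ ^ p ∂jacobiMeasure α β) ^ (1 / p)) := by
      rw [hf.eLpNorm_eq_integral_rpow_norm (by simpa using hp0) ENNReal.ofReal_ne_top,
        ENNReal.toReal_ofReal hp0.le, ENNReal.ofReal_mul (by positivity),
        ENNReal.ofReal_mul (by positivity), ENNReal.ofReal_coe_nnreal,
        ← ENNReal.ofReal_rpow_of_pos hM0, ENNReal.ofReal_toReal hM.ne, one_div p]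
    have hroot : ∀ {x y : ℝ≥0∞}, x ≤ y ^ s → x ^ (1 / s) ≤ y := fun h => by
      rw [one_div]
      exact (ENNReal.rpow_inv_le_iff hs0).2 h
    rw [hrhs]
    refine hroot ?_
    rw [ENNReal.tsum_eq_iSup_sum]
    refine iSup_le fun F => ?_
    have hnn : ∀ n : ℕ, 0 ≤ ((n : ℝ) + 1) ^ ((2 / s - 1) * jacobiSigma α β)
        * ω n ^ (1 / s - 1 / p') * ‖jacobiCoeff α β f n‖ := fun n => by
      have := hω n
      positivity
    simp only [ENNReal.ofReal_rpow_of_nonneg (hnn _) hs0.le]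
    rw [ENNReal.ofReal_rpow_of_nonneg (by positivity) hs0.le,
      ← ENNReal.ofReal_sum_of_nonneg fun n _ => Real.rpow_nonneg (hnn n) _]
    exact ENNReal.ofReal_le_ofReal (hC p hp hp2 p' s hpp hs1 hs2 ω hω hM f hf F)
  · intro q q' r r' hq hqq hr1 hr2 hrr ω hω hM φ _ hφ
    obtain ⟨K, hB⟩ := exists_isBesselSystem_jacobiON hα hβ
    have hq0 : 0 < q := by linarith
    have hq'1 : 1 < q' := by
      have h1 : 0 < 1 / q := by positivity
      have h2 : 1 / q ≤ 1 / 2 := one_div_le_one_div_of_le two_pos hq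
      have h3 : 0 < q' := one_div_pos.1 (by linarith)
      rw [← one_div_lt_one_div h3 one_pos]
      linarith
    have hq'2 : q' ≤ 2 := by
      have h2 : 1 / q ≤ 1 / 2 := one_div_le_one_div_of_le two_pos hq
      rw [← one_div_le_one_div two_pos (by linarith)]
      linarith
    have hr : 1 < r := by linarith
    have hr'0 : 0 < r' := by
      have h1 : 1 / r < 1 := by rw [div_lt_one (by linarith)]; exact hr
      exact one_div_pos.1 (by linarith)
    have hM0 := toReal_paleyM_pos hω hM
    set v : ℕ → ℝ := fun n => ((n : ℝ) + 1) ^ ((1 - 2 / r) * jacobiSigma α β)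
      * ω n ^ (1 / q - 1 / r) with hv
    have hv0 : ∀ n, 0 < v n := fun n => by
      have := hω n
      positivity
    have hvinv : ∀ n, (v n)⁻¹ = ((n : ℝ) + 1) ^ ((2 / r - 1) * jacobiSigma α β)
        * ω n ^ (1 / r - 1 / q) := by
      intro n
      have hn : (0 : ℝ) ≤ (n : ℝ) + 1 := by positivity
      rw [hv, mul_inv, ← Real.rpow_neg hn, ← Real.rpow_neg (hω n).le]
      congr 2 <;> ring
    have hnn : ∀ n, 0 ≤ v n * |φ n| := fun n => mul_nonneg (hv0 n).le (abs_nonneg _)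
    have hφ' : Summable fun n => (v n * |φ n|) ^ r' := by
      change ∑' n : ℕ, ENNReal.ofReal (v n * |φ n|) ^ r' < ∞ at hφ
      simp only [ENNReal.ofReal_rpow_of_nonneg (hnn _) hr'0.le] at hφ
      refine (ENNReal.summable_toReal hφ.ne).congr fun n => ?_
      exact ENNReal.toReal_ofReal (Real.rpow_nonneg (hnn n) _)
    have htsum : ∑' n : ℕ, ENNReal.ofReal (v n * |φ n|) ^ r'
        = ENNReal.ofReal (∑' n, (v n * |φ n|) ^ r') := by
      simp only [ENNReal.ofReal_rpow_of_nonneg (hnn _) hr'0.le]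
      exact (ENNReal.ofReal_tsum_of_nonneg (fun n => Real.rpow_nonneg (hnn n) _) hφ').symm
    obtain ⟨f, hf, hlim, hcoeff, hnorm⟩ := hB.exists_memLp_of_summable
      (integral_jacobiON_mul_jacobiON hα hβ) (V := C q' * (paleyM α β ω).toReal ^ (1 / r - 1 / q))
      hq hqq hr hrr hv0 (by positivity) (fun g hg F => by
        have h1 := hC q' hq'1 hq'2 q r (by linarith) hr1 hr2 ω hω hM g hg F
        simp only [← hvinv] at h1
        exact h1) hφ'
    refine ⟨f, hf, hlim, hcoeff, hnorm.trans (le_of_eq ?_)⟩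
    have hS0 : 0 ≤ ∑' n, (v n * |φ n|) ^ r' := tsum_nonneg fun n => Real.rpow_nonneg (hnn n) _
    change _ = _ * (∑' n : ℕ, ENNReal.ofReal (v n * |φ n|) ^ r') ^ (1 / r')
    rw [htsum, ENNReal.ofReal_rpow_of_nonneg hS0 (by positivity), ENNReal.ofReal_mul (by positivity),
      ENNReal.ofReal_mul (by positivity), ENNReal.ofReal_coe_nnreal,
      ← ENNReal.ofReal_rpow_of_pos hM0, ENNReal.ofReal_toReal hM.ne]
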